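/- **Setting.** Terms are two-sorted (*integer*, a subsort of *general*) and are built from variables of both sorts, numerals (sort integer), the arithmetic functions $+,-,\times$ on the integer sort, and further sorted function and object constants; a term is *precomputed* if it is ground and contains no arithmetic function. Atomic formulas are atoms $p(\mathbf t)$ with $p$ a predicate symbol, equalities and comparisons of terms. A rule has an atomic formula or $\bot$ as its head, and as its body a finite list of atomic formulas, each preceded by zero, one or two occurrences of *not*. Substitutions respect sorts. For a term $t$, $[t]$ denotes the result of evaluating the ground arithmetic subterms of $t$ to numerals, and $[(t_1,\dots,t_n)]=([t_1],\dots,[t_n])$. A *simple intensionality statement* $\kappa$ maps each $n$-ary predicate symbol $p$ to a finite set $\kappa^p$ of $n$-tuples whose elements are variables or precomputed terms, no variable occurring twice in a tuple; $\lambda_\kappa^p(X_1,\dots,X_n)$ is the formula $\bigvee_{(t_1,\dots,t_n)\in\kappa^p}\bigwedge_{t_i\text{ not a variable}}X_i=t_i$. A *module* is a pair $\Delta=\langle\kappa,\Pi\rangle$ of such a statement and a finite set $\Pi$ of rules. A *modular program* is a pair $\mathcal P=\langle\kappa,\{\Delta_1,\dots,\Delta_n\}\rangle$ of a simple intensionality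 statement and a finite family of modules $\Delta_i=\langle\kappa_i,\Pi_i\rangle$ such that $\forall\mathbf X(\lambda^p_{\kappa_i}(\mathbf X)\to\lambda^p_\kappa(\mathbf X))$ is valid in standard interpretations (the integers are the numerals with the usual arithmetic, the general domain contains the precomputed terms, and general object constants denote themselves) for all $i$ and $p$. Say that $\mathbf t$ *matches* $\kappa^p$ if $[\mathbf t]=\mathbf u\theta$ for some $\mathbf u\in\kappa^p$ and some substitution $\theta$. The program is *simple* if, for every module $\Delta_i$, whenever an atom $p(\mathbf t)$ is the head of a rule in $\Pi_i$, $\mathbf t$ matches $\kappa_i^p$. The *dependency graph* of $\mathcal P$ has as vertices the pairs $(p,i)$ with $p$ a predicate symbol and $1\le i\le n$, and an edge from $(p,i)$ to $(q,j)$ if some rule of some module of $\mathcal P$ has head $p(\mathbf t)$ and a nonnegated atom $q(\mathbf t')$ in its body such that $\mathbf t$ matches $\kappa_i^p$ and $\mathbf t'$ matches $\kappa_j^q$. The program is *coherent* if (a) it is simple; (b) for every strongly connected component of its dependency graph there is an $i$ such that all vertices of the component have the form $(p,i)$; and (c) for all $i\ne j$, all $p$, all $\mathbf u\in\kappa_i^p$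 and $\mathbf w\in\kappa_j^p$, $\mathbf u$ and $\mathbf w$ do not unify, i.e. no single substitution $\theta$ gives $\mathbf u\theta=\mathbf w\theta$. **Theorem.** Deciding whether a given modular program is coherent is feasible in polynomial time: there are a Turing machine and a polynomial $f$ such that, for every modular program $\mathcal P$, written as a string over a finite alphabet (numerals and symbol names in binary), the machine started on this string halts after at most $f(\ell)$ steps, where $\ell$ is the length of the string, and outputs whether $\mathcal P$ is coherent. -/

import Mathlib

namespace ModASP

/-! ### Terms -/

/-- The two sorts; the integer sort is a subsort of the general sort. -/
inductive Srt where
  | int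
  | gen
  deriving DecidableEq

/-- `s.Sub s'`: the sort `s` is a subsort of the sort `s'`. -/
def Srt.Sub (s s' : Srt) : Prop := s = s' ∨ s' = Srt.gen

/-- Object variables: infinitely many of each sort. -/
structure Var where
  sort : Srt
  idx : ℕ
  deriving DecidableEq

/-- Arithmetic function constants. -/
inductive Arith where
  | add
  | sub
  | mul
  deriving DecidableEq

/-- The customary meaning of the arithmetic function constants. -/
def Arith.eval : Arith → ℤ → ℤ → ℤ
  | .add, m, n => m + n
  | .sub, m, n => m - n
  | .mul, m, n => m * n

/-- The function constants of a signature other than numerals and arithmetic function constants,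
with their argument sorts and their value sort; object constants are those without arguments.
A symbol carries its sorts, so the signature of a program is implicit: it consists of the symbols
that occur in it. -/
structure FunSym where
  idx : ℕ
  args : List Srt
  res : Srt
  deriving DecidableEq

/-- Predicate symbols, with their argument sorts; the arity is `p.args.length`. -/
structure PredSym where
  idx : ℕ
  args : List Srt
  deriving DecidableEq

/-- Term expressions; `Term.WellSorted` singles out the terms. -/
inductive Term where
  | var (v : Var)
  | num (z : ℤ)
  | arith (op : Arith) (a b : Term)
  | app (f : FunSym) (ts : List Term)

/-- The sort of a term. -/
def Term.sort : Term → Srt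
  | .var v => v.sort
  | .num _ => Srt.int
  | .arith _ _ _ => Srt.int
  | .app f _ => f.res

mutual
/-- All arguments of functions are of appropriate sorts. -/
def Term.WellSorted : Term → Prop
  | .var _ => True
  | .num _ => True
  | .arith _ a b => a.WellSorted ∧ b.WellSorted ∧ a.sort = Srt.int ∧ b.sort = Srt.int
  | .app f ts => Term.WellSortedList ts f.args
/-- `ts` is a tuple of terms that can serve as arguments of sorts `ss`. -/
def Term.WellSortedList : List Term → List Srt → Prop
  | [], [] => True
  | t :: ts, s :: ss => t.WellSorted ∧ t.sort.Sub s ∧ Term.WellSortedList ts ss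
  | _, _ => False
end

mutual
/-- Precomputed terms: ground terms without arithmetic function constants. -/
def Term.Precomputed : Term → Prop
  | .var _ => False
  | .num _ => True
  | .arith _ _ _ => False
  | .app _ ts => Term.PrecomputedList ts
def Term.PrecomputedList : List Term → Prop
  | [] => True
  | t :: ts => t.Precomputed ∧ Term.PrecomputedList ts
end

mutual
/-- The operation `[t]`, which evaluates the ground arithmetic subterms of `t`. Sums, differences
and products of terms that do not evaluate to numerals (in particular nonground ones) are kept,
and other function constants are passed through. -/
def Term.norm : Term → Term
  | .var v => .var v
  | .num z => .num z
  | .arith op a b =>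
    match a.norm, b.norm with
    | .num m, .num n => .num (op.eval m n)
    | a', b' => .arith op a' b'
  | .app f ts => .app f (Term.normList ts)
/-- The operation `[t]`, applied to each element of a tuple. -/
def Term.normList : List Term → List Term
  | [] => []
  | t :: ts => t.norm :: Term.normList ts
end

/-- Substitutions: variables are replaced by terms of their sort (or of a subsort of it). -/
structure Subst where
  map : Var → Term
  wellSorted : ∀ v, (map v).WellSorted
  sort_sub : ∀ v, (map v).sort.Sub v.sort

mutual
/-- The result of applying a substitution to a term. -/
def Term.subst (θ : Subst) : Term → Term
  | .var v => θ.map v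
  | .num z => .num z
  | .arith op a b => .arith op (a.subst θ) (b.subst θ)
  | .app f ts => .app f (Term.substList θ ts)
/-- The result of applying a substitution to a tuple of terms. -/
def Term.substList (θ : Subst) : List Term → List Term
  | [] => []
  | t :: ts => t.subst θ :: Term.substList θ ts
end

/-- Two tuples unify: one substitution, applied to both, makes them equal. -/
def Unify (us ws : List Term) : Prop :=
  ∃ θ : Subst, Term.substList θ us = Term.substList θ ws

/-! ### Rules and programs -/

/-- Expressions `p(t₁, …, tₙ)`. -/
structure Atom where
  pred : PredSym
  args : List Term

/-- The terms of the atom have sorts that are subsorts of the argument sorts of the predicate. -/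
def Atom.WellSorted (A : Atom) : Prop := Term.WellSortedList A.args A.pred.args

/-- Comparison predicate constants. -/
inductive Cmp where
  | le
  | lt
  | ge
  | gt
  | ne
  deriving DecidableEq

/-- Atomic formulas: atoms `p(t₁, …, tₙ)`, equalities and comparisons. -/
inductive AtomicFormula where
  | atom (A : Atom)
  | eq (a b : Term)
  | cmp (c : Cmp) (a b : Term)

def AtomicFormula.WellSorted : AtomicFormula → Prop
  | .atom A => A.WellSorted
  | .eq a b => a.WellSorted ∧ b.WellSorted
  | .cmp _ a b => a.WellSorted ∧ b.WellSorted

/-- Literals: atomic formulas preceded by zero, one or two occurrences of `not`. -/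
inductive Literal where
  | pos (F : AtomicFormula)
  | not (F : AtomicFormula)
  | notNot (F : AtomicFormula)

def Literal.WellSorted : Literal → Prop
  | .pos F => F.WellSorted
  | .not F => F.WellSorted
  | .notNot F => F.WellSorted

/-- Rules; the head `none` stands for `⊥`. -/
structure Rule where
  head : Option AtomicFormula
  body : List Literal

def Rule.WellSorted (r : Rule) : Prop :=
  (∀ F, r.head = some F → F.WellSorted) ∧ ∀ L ∈ r.body, L.WellSorted

/-! ### Intensionality statements -/

/-- Finite (presentations of) functions `κ` that map predicate symbols to sets of tuples:
`κ` maps `p` to the set of all `u` such that `p(u)` is in the list. -/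
abbrev Intensionality := List Atom

/-- The set `κ^p`. -/
def Intensionality.tuples (κ : Intensionality) (p : PredSym) : Set (List Term) :=
  {u | Atom.mk p u ∈ κ}

/-- The conditions on a tuple in a simple intensionality statement: each element is a variable or
a precomputed term, and no variable occurs twice. -/
def SimpleTuple (u : List Term) : Prop :=
  (∀ t ∈ u, (∃ v, t = Term.var v) ∨ (t.WellSorted ∧ t.Precomputed)) ∧
  u.Pairwise fun t t' => ∀ v, t = Term.var v → t' ≠ Term.var v

/-- Simple intensionality statements. -/
def Intensionality.Simple (κ : Intensionality) : Prop :=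
  ∀ p, ∀ u ∈ κ.tuples p, u.length = p.args.length ∧ SimpleTuple u

/-- Standard interpretations, as far as they concern terms (the formulas below contain no predicate
constant but equality). The domain of the general sort contains the precomputed terms, the domain
of the integer sort is the set of numerals; object constants of the general sort are interpreted as
themselves, arithmetic functions as customary. -/
structure StandardInterpretation where
  Dom : Type
  name : Term → Dom
  name_inj : Set.InjOn name {t | t.WellSorted ∧ t.Precomputed}
  arith : Arith → Dom → Dom → Dom
  arith_eq : ∀ op m n, arith op (name (.num m)) (name (.num n)) = name (.num (op.eval m n))
  fn : FunSym → List Dom → Dom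
  fn_const : ∀ c, fn ⟨c, [], Srt.gen⟩ [] = name (.app ⟨c, [], Srt.gen⟩ [])
  fn_int : ∀ f ds, f.res = Srt.int →
    List.Forall₂ (fun d s => s = Srt.int → ∃ z, d = name (.num z)) ds f.args →
    ∃ z, fn f ds = name (.num z)

namespace StandardInterpretation

variable (I : StandardInterpretation)

/-- `d` is an element of the domain of the sort `s`. -/
def HasSort (d : I.Dom) (s : Srt) : Prop := s = Srt.int → ∃ z, d = I.name (.num z)

mutual
/-- The value of a ground term (the clause for variables is a dummy). -/
def value : Term → I.Dom
  | .var v => I.name (.var v)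
  | .num z => I.name (.num z)
  | .arith op a b => I.arith op (value a) (value b)
  | .app f ts => I.fn f (valueList ts)
def valueList : List Term → List I.Dom
  | [] => []
  | t :: ts => value t :: valueList ts
end

/-- Satisfaction of the formula `λ^p(X)` associated with `p` by `κ`, for the values `d` of `X`:
for some tuple `u` in `κ^p`, `Xᵢ = uᵢ` whenever `uᵢ` is not a variable. -/
def SatLam (κ : Intensionality) (p : PredSym) (d : List I.Dom) : Prop :=
  ∃ u ∈ κ.tuples p, List.Forall₂ (fun t x => (∀ v, t ≠ Term.var v) → x = I.value t) u d

end StandardInterpretation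

/-- The sentence `∀ X (λ₁^p(X) → λ^p(X))` is valid, where the `λ`s are associated with `p` by
`κ₁` and `κ`. -/
def LamImplies (κ₁ κ : Intensionality) (p : PredSym) : Prop :=
  ∀ (I : StandardInterpretation) (d : List I.Dom), List.Forall₂ I.HasSort d p.args →
    I.SatLam κ₁ p d → I.SatLam κ p d

/-! ### Modules and modular programs -/

/-- A pair of an intensionality statement and a finite set of rules. -/
structure LPModule where
  int : Intensionality
  rules : List Rule

/-- The intensionality statement of the module is simple, and its rules are over the signature. -/
def LPModule.WellFormed (Δ : LPModule) : Prop :=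
  Δ.int.Simple ∧ ∀ r ∈ Δ.rules, r.WellSorted

/-- Modular programs. The modules form a finite family, indexed by their position in the list. -/
structure ModularProgram where
  int : Intensionality
  modules : List LPModule
  simple_int : int.Simple
  wellFormed : ∀ Δ ∈ modules, Δ.WellFormed
  implies : ∀ Δ ∈ modules, ∀ p, LamImplies Δ.int int p

/-- There are a tuple `u` in `κ^p` and a substitution `θ` such that `[t] = u θ`. -/
def Matches (κ : Intensionality) (p : PredSym) (t : List Term) : Prop :=
  ∃ u ∈ κ.tuples p, ∃ θ : Subst, Term.normList t = Term.substList θ u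

/-- Simple modules. -/
def LPModule.Simple (Δ : LPModule) : Prop :=
  ∀ r ∈ Δ.rules, ∀ p t, r.head = some (.atom ⟨p, t⟩) → Matches Δ.int p t

namespace ModularProgram

variable (P : ModularProgram)

/-- Simple modular programs. -/
def Simple : Prop := ∀ Δ ∈ P.modules, Δ.Simple

/-- Vertices of the dependency graph. (Predicate symbols that do not occur in the program give
isolated vertices only.) -/
abbrev Vertex := PredSym × Fin P.modules.length

/-- The edges of the dependency graph, from `(p, i)` to `(q, j)`. -/
def Edge (v w : P.Vertex) : Prop :=
  ∃ Δ ∈ P.modules, ∃ r ∈ Δ.rules, ∃ t t' : List Term,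
    r.head = some (.atom ⟨v.1, t⟩) ∧
    Literal.pos (.atom ⟨w.1, t'⟩) ∈ r.body ∧
    Matches (P.modules.get v.2).int v.1 t ∧
    Matches (P.modules.get w.2).int w.1 t'

/-- The strongly connected component of a vertex of the dependency graph. -/
def component (v : P.Vertex) : Set P.Vertex :=
  {w | Relation.ReflTransGen P.Edge v w ∧ Relation.ReflTransGen P.Edge w v}

/-- Coherent modular programs. -/
def Coherent : Prop :=
  P.Simple ∧
  (∀ v : P.Vertex, ∃ i, ∀ w ∈ P.component v, w.2 = i) ∧
  (∀ i j : Fin P.modules.length, i ≠ j → ∀ p,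
    ∀ u ∈ (P.modules.get i).int.tuples p, ∀ w ∈ (P.modules.get j).int.tuples p, ¬ Unify u w)

end ModularProgram

/-! ### The input as a string over a finite alphabet -/

/-- The finite input alphabet. -/
inductive Tok where
  | bit (b : Bool)
  | fin
  | minus
  | plus
  | sort (s : Srt)
  | opn
  | cls
  | var
  | num
  | arith (op : Arith)
  | app
  | atom
  | eq
  | cmp (c : Cmp)
  | pos
  | not
  | notNot
  | bot
  deriving DecidableEq

/-- Natural numbers are written in binary. -/
def encNat (n : ℕ) : List Tok := (Computability.encodeNat n).map Tok.bit ++ [Tok.fin]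

def encInt (z : ℤ) : List Tok := (if z < 0 then Tok.minus else Tok.plus) :: encNat z.natAbs

/-- Lists are written between brackets. -/
def encList {α : Type} (f : α → List Tok) (l : List α) : List Tok :=
  Tok.opn :: (l.flatMap f ++ [Tok.cls])

def FunSym.enc (f : FunSym) : List Tok :=
  encNat f.idx ++ encList (fun s => [Tok.sort s]) f.args ++ [Tok.sort f.res]

def PredSym.enc (p : PredSym) : List Tok :=
  encNat p.idx ++ encList (fun s => [Tok.sort s]) p.args

mutual
/-- Terms are written in prefix notation. -/
def Term.enc : Term → List Tok
  | .var v => [Tok.var, Tok.sort v.sort] ++ encNat v.idx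
  | .num z => Tok.num :: encInt z
  | .arith op a b => Tok.arith op :: (a.enc ++ b.enc)
  | .app f ts => Tok.app :: (f.enc ++ Tok.opn :: (Term.encAll ts ++ [Tok.cls]))
def Term.encAll : List Term → List Tok
  | [] => []
  | t :: ts => t.enc ++ Term.encAll ts
end

def Atom.enc (A : Atom) : List Tok := Tok.atom :: (A.pred.enc ++ encList Term.enc A.args)

def AtomicFormula.enc : AtomicFormula → List Tok
  | .atom A => A.enc
  | .eq a b => Tok.eq :: (a.enc ++ b.enc)
  | .cmp c a b => Tok.cmp c :: (a.enc ++ b.enc)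

def Literal.enc : Literal → List Tok
  | .pos F => Tok.pos :: F.enc
  | .not F => Tok.not :: F.enc
  | .notNot F => Tok.notNot :: F.enc

def Rule.enc (r : Rule) : List Tok :=
  (match r.head with
    | none => [Tok.bot]
    | some F => F.enc) ++ encList Literal.enc r.body

def Intensionality.enc (κ : Intensionality) : List Tok := encList Atom.enc κ

def LPModule.enc (Δ : LPModule) : List Tok :=
  Intensionality.enc Δ.int ++ encList Rule.enc Δ.rules

/-- The string that presents a modular program. -/
def ModularProgram.enc (P : ModularProgram) : List Tok :=
  Intensionality.enc P.int ++ encList LPModule.enc P.modules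

open Classical in
/-- The property `p` of the objects of type `α`, presented as strings by `enc`, is decided by a
Turing machine (with finitely many stacks, each a half-tape) in time polynomial in the length of
the presentation. -/
def DecidableInPolyTime {α Γ : Type} (enc : α → List Γ) (p : α → Prop) : Prop :=
  Nonempty (Turing.TM2ComputableInPolyTime enc Computability.encodeBool fun a => decide (p a))

end ModASP

namespace ModASP

section

open Turing Function

/-! ### Structured stack programs -/

-- Coherence is a conjunction of three conditions, each of which comes down to elementary tests on
-- syntax trees. Entries of the tuples in a simple intensionality statement are variables or
-- precomputed terms, and no variable is repeated. Hence `[t] = uθ` can be tested position by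
-- position: a precomputed entry must equal the entry of `[t]`, and a variable only imposes a
-- condition on the sort (`matchAtom_iff`). This settles (a) and gives the list of edges of the
-- dependency graph. Condition (b) says that no edge between different modules lies on a closed walk
-- (`component_iff`), a reachability question. For (c), where the two tuples may share variables,
-- join corresponding entries by edges. A unifier takes one value on each connected component and
-- fixes precomputed terms, so it exists exactly if every precomputed term is connected only with
-- itself and with variables whose sort admits it (`unifyTuple_iff`).
--
-- Evaluating ground arithmetic does no harm: the length of a sum, difference or product is at most
-- the sum of the lengths of the operands plus a constant, and the operands are consumed. So a
-- parser that reads from right to left and evaluates on the way has a state that grows by a bounded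
-- amount per token (`repSize_parseStep_le`); it ends with the trees of the normalized program
-- (`ModularProgram.parses`).
--
-- On the machine side, structured stack programs are compiled to stack machines (`Run.steps`). Data
-- are binary trees, written in prefix notation on one stack. Functions computable in polynomial
-- time are closed under composition, pairing, case distinction, and iteration with polynomially
-- many states of polynomial size (`Computes.loop`), hence under suitable folds over lists
-- (`PolyTime.foldl`). The decision procedure is composed of such functions, so `fun_prop` can
-- assemble its time bound. `ModularProgram.coherentTest_iff` is its correctness, and
-- `PolyTime.nonempty_tm` turns it into a machine.

instance : Fintype Tok where
  elems := {.bit true, .bit false, .fin, .minus, .plus, .sort .int, .sort .gen, .opn, .cls, .var,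
    .num, .arith .add, .arith .sub, .arith .mul, .app, .atom, .eq, .cmp .le, .cmp .lt, .cmp .ge,
    .cmp .gt, .cmp .ne, .pos, .not, .notNot, .bot}
  complete t := by
    rcases t with b | _ | _ | _ | s | _ | _ | _ | _ | op | _ | _ | _ | c | _ | _ | _ | _
    all_goals first | (simp; done) | (cases s <;> simp) | (cases op <;> simp) |
      (cases c <;> simp)

/-- Stacks: the input stack `none`, the main stack `some 0`, and three scratch stacks. -/
abbrev Stk := Option (Fin 4)

/-- Stack alphabets. -/
abbrev StkSym : Stk → Type
  | none => Tok
  | some _ => Bool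

/-- The internal memory of the machine. -/
abbrev Mem := Option Bool × Option Bool × Option Tok

/-- Contents of all stacks. -/
abbrev Stks := ∀ k, List (StkSym k)

/-- Blocks: statements that are executed in one step and exit with a result in `Λ`. -/
abbrev Block (Λ : Type) := TM2.Stmt StkSym Λ Mem

/-- Renaming of the exits of a block. -/
def Block.map {Λ Λ' : Type} (g : Λ → Λ') : Block Λ → Block Λ'
  | .push k f q => .push k f (Block.map g q)
  | .peek k f q => .peek k f (Block.map g q)
  | .pop k f q => .pop k f (Block.map g q)
  | .load f q => .load f (Block.map g q)
  | .branch f q r => .branch f (Block.map g q) (Block.map g r)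
  | .goto f => .goto fun v => g (f v)
  | .halt => .halt

theorem Block.stepAux_map {Λ Λ' : Type} (g : Λ → Λ') (s : Block Λ) (v : Mem) (S : Stks) :
    TM2.stepAux (s.map g) v S =
      ⟨(TM2.stepAux s v S).l.map g, (TM2.stepAux s v S).var, (TM2.stepAux s v S).stk⟩ := by
  induction s generalizing v S with
  | push k f q ih => simp [Block.map, ih]
  | peek k f q ih => simp [Block.map, ih]
  | pop k f q ih => simp [Block.map, ih]
  | load f q ih => simp [Block.map, ih]
  | branch f q r ih1 ih2 => cases h : f v <;> simp [Block.map, ih1, ih2, h]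
  | goto f => simp [Block.map]
  | halt => simp [Block.map]

/-- Structured programs. -/
inductive Prog
  | blk (s : Block Unit)
  | seq (p q : Prog)
  | ite (s : Block Bool) (p q : Prog)
  | loop (s : Block Bool) (p : Prog)

/-- `s.Exits x S S'`: the block `s` exits with the result `x` and turns `S` into `S'`, whatever the
memory contains. -/
def Block.Exits {Λ : Type} (s : Block Λ) (x : Λ) (S S' : Stks) : Prop :=
  ∀ v, ∃ v', TM2.stepAux s v S = ⟨some x, v', S'⟩

/-- `Run p S S' n`: the program `p` turns `S` into `S'` in at most `n` steps. -/
inductive Run : Prog → Stks → Stks → ℕ → Prop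
  | blk {s S S'} : s.Exits () S S' → Run (.blk s) S S' 1
  | seq {p q S S' S'' n m} : Run p S S' n → Run q S' S'' m → Run (.seq p q) S S'' (n + m)
  | ite_true {s p q S S' S'' n} : s.Exits true S S' → Run p S' S'' n →
      Run (.ite s p q) S S'' (n + 1)
  | ite_false {s p q S S' S'' n} : s.Exits false S S' → Run q S' S'' n →
      Run (.ite s p q) S S'' (n + 1)
  | loop_false {s p S S'} : s.Exits false S S' → Run (.loop s p) S S' 1
  | loop_true {s p S S' S'' S''' n m} : s.Exits true S S' → Run p S' S'' n →
      Run (.loop s p) S'' S''' m → Run (.loop s p) S S''' (m + n + 1)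
  | mono {p S S' n m} : Run p S S' n → n ≤ m → Run p S S' m

/-! ### Compilation to stack machines -/

/-- Labels of the code of a program. -/
def Prog.Lab : Prog → Type
  | .blk _ => Unit
  | .seq p q => p.Lab ⊕ q.Lab
  | .ite _ p q => Option (p.Lab ⊕ q.Lab)
  | .loop _ p => Option p.Lab

@[reducible]
def Prog.labFintype : ∀ p : Prog, Fintype p.Lab
  | .blk _ => inferInstanceAs (Fintype Unit)
  | .seq p q =>
    have := p.labFintype
    have := q.labFintype
    inferInstanceAs (Fintype (p.Lab ⊕ q.Lab))
  | .ite _ p q =>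
    have := p.labFintype
    have := q.labFintype
    inferInstanceAs (Fintype (Option (p.Lab ⊕ q.Lab)))
  | .loop _ p =>
    have := p.labFintype
    inferInstanceAs (Fintype (Option p.Lab))

/-- The label where a program starts. -/
def Prog.start : ∀ p : Prog, p.Lab
  | .blk _ => ()
  | .seq p _ => Sum.inl p.start
  | .ite _ _ _ => (none : Option _)
  | .loop _ _ => (none : Option _)

/-- The code of a program, placed by `emb` in a machine with labels `Λ`, that continues at `exit`. -/
def Prog.code {Λ : Type} : ∀ p : Prog, (p.Lab → Λ) → Λ → p.Lab → Block Λ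
  | .blk s, _, exit => fun _ => s.map fun _ => exit
  | .seq p q, emb, exit =>
    Sum.elim (p.code (fun l => emb (Sum.inl l)) (emb (Sum.inr q.start)))
      (q.code (fun l => emb (Sum.inr l)) exit)
  | .ite s p q, emb, exit => fun l =>
    match (l : Option (p.Lab ⊕ q.Lab)) with
    | none => s.map fun b =>
        cond b (emb (some (Sum.inl p.start) : Option _)) (emb (some (Sum.inr q.start) : Option _))
    | some (Sum.inl l) => p.code (fun l => emb (some (Sum.inl l) : Option _)) exit l
    | some (Sum.inr l) => q.code (fun l => emb (some (Sum.inr l) : Option _)) exit l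
  | .loop s p, emb, exit => fun l =>
    match (l : Option p.Lab) with
    | none => s.map fun b => cond b (emb (some p.start : Option _)) exit
    | some l => p.code (fun l => emb (some l : Option _)) (emb (none : Option _)) l

/-- `n` steps of a machine. -/
def Steps {Λ : Type} (M : Λ → Block Λ) (n : ℕ) (c c' : TM2.Cfg StkSym Λ Mem) : Prop :=
  (flip bind (TM2.step M))^[n] (some c) = some c'

theorem Steps.trans {Λ : Type} {M : Λ → Block Λ} {n m : ℕ} {c c' c'' : TM2.Cfg StkSym Λ Mem}
    (h : Steps M n c c') (h' : Steps M m c' c'') : Steps M (n + m) c c'' := by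
  unfold Steps at *
  rw [Nat.add_comm, iterate_add_apply, h, h']

/-- A machine executes a whole statement in one step, so a block costs one step however long it is.
-/
theorem Steps.one {Λ Λ' : Type} {M : Λ → Block Λ} {l : Λ} {s : Block Λ'} {x : Λ'} {g : Λ' → Λ}
    {v v' : Mem} {S S' : Stks} (hM : M l = s.map g) (h : TM2.stepAux s v S = ⟨some x, v', S'⟩) :
    Steps M 1 ⟨some l, v, S⟩ ⟨some (g x), v', S'⟩ := by
  simp only [Steps, iterate_one, flip, Option.bind_eq_bind, Option.bind_some, TM2.step, hM,
    Block.stepAux_map, h, Option.map_some]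

/-- Correctness of the compilation, by induction on the run. The machine is arbitrary apart from
containing the code of `p`, so the induction hypotheses apply to subprograms inside the same
machine; the initial memory is arbitrary because no exit of a block depends on it. -/
theorem Run.steps {p : Prog} {S S' : Stks} {n : ℕ} (h : Run p S S' n) {Λ : Type}
    (M : Λ → Block Λ) (emb : p.Lab → Λ) (exit : Λ) (hM : ∀ l, M (emb l) = p.code emb exit l)
    (v : Mem) :
    ∃ v' t, t ≤ n ∧ Steps M t ⟨some (emb p.start), v, S⟩ ⟨some exit, v', S'⟩ := by
  induction h generalizing exit v with
  | blk h =>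
    obtain ⟨v', h⟩ := h v
    exact ⟨v', 1, le_rfl, Steps.one (g := fun _ => exit) (hM ()) h⟩
  | seq _ _ ih1 ih2 =>
    obtain ⟨v1, t1, ht1, h1⟩ := ih1 _ _ (fun l => hM (Sum.inl l)) v
    obtain ⟨v2, t2, ht2, h2⟩ := ih2 _ _ (fun l => hM (Sum.inr l)) v1
    exact ⟨v2, t1 + t2, by omega, h1.trans h2⟩
  | ite_true h _ ih =>
    obtain ⟨v1, h⟩ := h v
    obtain ⟨v2, t2, ht2, h2⟩ := ih _ _ (fun l => hM (some (Sum.inl l) : Option _)) v1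
    exact ⟨v2, 1 + t2, by omega, (Steps.one (hM (none : Option _)) h).trans h2⟩
  | ite_false h _ ih =>
    obtain ⟨v1, h⟩ := h v
    obtain ⟨v2, t2, ht2, h2⟩ := ih _ _ (fun l => hM (some (Sum.inr l) : Option _)) v1
    exact ⟨v2, 1 + t2, by omega, (Steps.one (hM (none : Option _)) h).trans h2⟩
  | loop_false h =>
    obtain ⟨v1, h⟩ := h v
    exact ⟨v1, 1, le_rfl, Steps.one (hM (none : Option _)) h⟩
  | loop_true h _ _ ih1 ih2 =>
    obtain ⟨v1, h⟩ := h v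
    obtain ⟨v2, t2, ht2, h2⟩ := ih1 _ _ (fun l => hM (some l : Option _)) v1
    obtain ⟨v3, t3, ht3, h3⟩ := ih2 _ _ hM v2
    exact ⟨v3, 1 + t2 + t3, by omega, ((Steps.one (hM (none : Option _)) h).trans h2).trans h3⟩
  | mono _ hn ih =>
    obtain ⟨v', t, ht, h⟩ := ih _ _ hM v
    exact ⟨v', t, ht.trans hn, h⟩

/-- Stacks that are empty, except for the main stack. -/
def mainStk (l : List Bool) : Stks
  | none => []
  | some i => if i = 0 then l else []

/-- Stacks that are empty, except for the input stack. -/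
def inputStk (l : List Tok) : Stks
  | none => l
  | some _ => []

/-- The stack machine that executes a program. -/
def Prog.machine (p : Prog) : FinTM2 :=
  { K := Stk
    k₀ := none
    k₁ := some 0
    Γ := StkSym
    Λ := Option p.Lab
    main := some p.start
    ΛFin := have := p.labFintype; inferInstanceAs (Fintype (Option p.Lab))
    σ := Mem
    initialState := (none, none, none)
    Γk₀Fin := inferInstanceAs (Fintype Tok)
    m := fun l =>
      match l with
      | none => .load (fun _ => (none, none, none)) .halt
      | some l => p.code some none l }

theorem Prog.computableInPolyTime {α : Type} (enc : α → List Tok) (f : α → Bool) (p : Prog)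
    (q : Polynomial ℕ)
    (h : ∀ a, Run p (inputStk (enc a)) (mainStk [f a]) (q.eval (enc a).length)) :
    Nonempty (TM2ComputableInPolyTime enc Computability.encodeBool f) := by
  -- The additional step is the one at the label `none`, which restores the initial memory, as the
  -- halting configuration requires, and halts.
  refine ⟨⟨⟨p.machine, Equiv.refl _, Equiv.refl _⟩, q + 1, fun a => ?_⟩⟩
  have key : ∃ t, t ≤ q.eval (enc a).length ∧ (flip bind p.machine.step)^[t + 1]
      (some (initList p.machine ((enc a).map id))) = some (haltList p.machine ([f a].map id)) := by
    obtain ⟨v', t, ht, hs⟩ := (h a).steps p.machine.m some none (fun _ => rfl) (none, none, none)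
    refine ⟨t, ht, ?_⟩
    have e1 : initList p.machine ((enc a).map id) = ⟨some (some p.start), (none, none, none),
        inputStk (enc a)⟩ := by
      unfold initList
      congr 1
      funext k
      rcases k with _ | i
      · exact List.map_id _
      · rfl
    have e2 : haltList p.machine ([f a].map id) = ⟨none, (none, none, none), mainStk [f a]⟩ := by
      unfold haltList
      congr 1
      funext k
      rcases k with _ | i
      · rfl
      · by_cases hi : i = 0
        · subst hi; rfl
        · have : (some i : Stk) ≠ some 0 := by simpa using hi
          simp only [mainStk, hi, if_false]
          exact dif_neg this
    rw [e1, e2, Function.iterate_succ_apply']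
    unfold Steps at hs
    erw [hs]
    rfl
  refine ⟨⟨Classical.choose key + 1, ?_⟩, ?_⟩
  · exact (Classical.choose_spec key).2
  · simpa using (Classical.choose_spec key).1

end

section

open Turing Function

/-! ### Binary trees on stacks -/

/-- Binary trees, which serve as data of programs. -/
inductive Bin
  | leaf
  | node (a b : Bin)
  deriving DecidableEq

namespace Bin

/-- The number of nodes. -/
def size : Bin → ℕ
  | leaf => 1
  | node a b => a.size + b.size + 1

/-- Trees in prefix notation. -/
def flat : Bin → List Bool
  | leaf => [false]
  | node a b => true :: (a.flat ++ b.flat)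

/-- The tree that represents a truth value; both trees have the same size. -/
def ofBool : Bool → Bin
  | false => node leaf (node leaf leaf)
  | true => node (node leaf leaf) leaf

theorem length_flat (x : Bin) : x.flat.length = x.size := by
  induction x with
  | leaf => rfl
  | node a b iha ihb => simp [flat, size, iha, ihb]

theorem size_pos (x : Bin) : 0 < x.size := by
  cases x <;> simp [size]

/-- Prefix notation is self-delimiting. The remainders `r` and `s` make the induction pass through
the first subtree of a node. -/
theorem flat_append_inj {x y : Bin} {r s : List Bool} (h : x.flat ++ r = y.flat ++ s) :
    x = y ∧ r = s := by
  induction x generalizing y r s with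
  | leaf => cases y <;> simp_all [flat]
  | node a b iha ihb =>
    cases y with
    | leaf => simp [flat] at h
    | node c d =>
      simp only [flat, List.cons_append, List.append_assoc, List.cons.injEq, true_and] at h
      obtain ⟨rfl, h'⟩ := iha h
      obtain ⟨rfl, h''⟩ := ihb h'
      exact ⟨rfl, h''⟩

theorem flat_inj {x y : Bin} : x.flat = y.flat ↔ x = y :=
  ⟨fun h => (flat_append_inj (r := []) (s := []) (by simpa using h)).1, fun h => h ▸ rfl⟩

theorem size_ofBool (b : Bool) : (ofBool b).size = 5 := by cases b <;> rfl

theorem ofBool_injective : Injective ofBool := by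
  intro a b h
  cases a <;> cases b <;> simp_all [ofBool]

end Bin

/-- The main stack and the three scratch stacks; the input stack is empty. -/
def stks (m a b c : List Bool) : Stks
  | none => []
  | some 0 => m
  | some 1 => a
  | some 2 => b
  | some 3 => c

section
variable (m a b c l : List Bool)

theorem mainStk_eq : mainStk m = stks m [] [] [] := by
  funext k
  rcases k with _ | i
  · rfl
  · fin_cases i <;> rfl

@[simp] theorem stks_zero : stks m a b c (some 0) = m := rfl
@[simp] theorem stks_one : stks m a b c (some 1) = a := rfl
@[simp] theorem stks_two : stks m a b c (some 2) = b := rfl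
@[simp] theorem stks_three : stks m a b c (some 3) = c := rfl

@[simp] theorem update_stks_zero : update (stks m a b c) (some 0) l = stks l a b c := by
  funext k
  rcases k with _ | i
  · rfl
  · fin_cases i <;> rfl
@[simp] theorem update_stks_one : update (stks m a b c) (some 1) l = stks m l b c := by
  funext k
  rcases k with _ | i
  · rfl
  · fin_cases i <;> rfl
@[simp] theorem update_stks_two : update (stks m a b c) (some 2) l = stks m a l c := by
  funext k
  rcases k with _ | i
  · rfl
  · fin_cases i <;> rfl
@[simp] theorem update_stks_three : update (stks m a b c) (some 3) l = stks m a b l := by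
  funext k
  rcases k with _ | i
  · rfl
  · fin_cases i <;> rfl

end

theorem Block.Exits.intro {Λ : Type} {s : Block Λ} {x : Λ} {S S' : Stks}
    (h : ∀ v, (TM2.stepAux s v S).l = some x ∧ (TM2.stepAux s v S).stk = S') : s.Exits x S S' := by
  intro v
  refine ⟨(TM2.stepAux s v S).var, ?_⟩
  obtain ⟨h1, h2⟩ := h v
  rw [← h1, ← h2]

-- Stack programs that move, copy, exchange and compare trees

namespace Prog

open TM2.Stmt

/-- The program that does nothing. -/
def skip : Prog := .blk (goto fun _ => ())

/-- Repeat a block as long as it exits with `true`. -/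
def rep (s : Block Bool) : Prog := .loop s skip

theorem run_skip (S : Stks) : Run skip S S 1 :=
  .blk (.intro fun v => by simp)

theorem run_rep_true {s : Block Bool} {S S' S'' : Stks} {n : ℕ} (h : s.Exits true S S')
    (h' : Run (rep s) S' S'' n) : Run (rep s) S S'' (n + 2) :=
  .loop_true h (run_skip _) h'

/-- Push a symbol on the main stack. -/
def push (x : Bool) : Prog := .blk (.push (some 0) (fun _ => x) (goto fun _ => ()))

theorem run_push (x : Bool) (m a b c : List Bool) :
    Run (push x) (stks m a b c) (stks (x :: m) a b c) 1 :=
  .blk (.intro fun v => by simp)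

/-- Move a symbol of a tree to the first scratch stack. The third one counts, in unary, the trees
still to be read. -/
def readBlock : Block Bool :=
  .pop (some 3) (fun v x => (x, v.2)) (.branch (fun v => v.1.isSome)
    (.pop (some 0) (fun v x => (v.1, x, v.2.2)) (.push (some 1) (fun v => v.2.1.getD false)
      (.branch (fun v => v.2.1.getD false)
        (.push (some 3) (fun _ => true) (.push (some 3) (fun _ => true) (goto fun _ => true)))
        (goto fun _ => true))))
    (goto fun _ => false))

/-- Move a tree from the main stack to the first scratch stack. -/
def read : Prog :=
  .seq (.blk (.push (some 3) (fun _ => true) (goto fun _ => ()))) (rep readBlock)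

/-- The topmost `true` on the third scratch stack stands for `x`; reading the symbol of a node
replaces it by two, for the subtrees, and reading a leaf removes it. The rest of the run is a
hypothesis, so that the claims for the two subtrees can be chained. -/
theorem run_rep_readBlock (x : Bin) (m a b c : List Bool) (S : Stks) (n : ℕ)
    (h : Run (rep readBlock) (stks m (x.flat.reverse ++ a) b c) S n) :
    Run (rep readBlock) (stks (x.flat ++ m) a b (true :: c)) S (n + 2 * x.size) := by
  induction x generalizing m a c S n with
  | leaf =>
    exact run_rep_true (S' := stks m (false :: a) b c)
      (.intro fun v => by simp [readBlock, Bin.flat]) (by simpa [Bin.flat] using h)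
  | node x y ihx ihy =>
    have h1 := ihy m (x.flat.reverse ++ true :: a) c S n (by simpa [Bin.flat] using h)
    have h2 := ihx (y.flat ++ m) (true :: a) (true :: c) S _ h1
    refine (run_rep_true (.intro (S' := stks (x.flat ++ (y.flat ++ m)) (true :: a) b
      (true :: true :: c)) fun v => ?_) h2).mono ?_
    · simp [readBlock, Bin.flat]
    · simp only [Bin.size]; omega

theorem run_read (x : Bin) (m a b : List Bool) :
    Run read (stks (x.flat ++ m) a b []) (stks m (x.flat.reverse ++ a) b []) (2 * x.size + 2) := by
  refine (Run.seq (S' := stks (x.flat ++ m) a b [true]) (.blk (.intro fun v => by simp))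
    (run_rep_readBlock x m a b [] _ 1 (.loop_false (.intro fun v => ?_)))).mono (by omega)
  simp [readBlock]

/-- Move all symbols from the stack `i` to the stack `j`. -/
def flush (i j : Fin 4) : Prog :=
  rep (.pop (some i) (fun v x => (x, v.2)) (.branch (fun v => v.1.isSome)
    (.push (some j) (fun v => v.1.getD false) (goto fun _ => true)) (goto fun _ => false)))

theorem run_flush {i j : Fin 4} (hij : i ≠ j) (l : List Bool) (S : Stks) (h : S (some i) = l) :
    Run (flush i j) S (update (update S (some i) []) (some j) (l.reverse ++ S (some j)))
      (2 * l.length + 1) := by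
  have hji : (some j : Stk) ≠ some i := by simpa using hij.symm
  induction l generalizing S with
  | nil =>
    refine .loop_false (.intro fun v => ?_)
    have e' : update S (some i) [] = S := by rw [← h]; exact update_eq_self _ _
    simp [h, e']
  | cons x l ih =>
    have := ih (update (update S (some i) l) (some j) (x :: S (some j)))
      (by rw [update_of_ne hji.symm, update_self])
    refine (run_rep_true (.intro (S' := update (update S (some i) l) (some j) (x :: S (some j)))
      fun v => ?_) (S'' := _) (n := 2 * l.length + 1) ?_).mono (by simp; omega)
    · simp [h, hji]
    · rw [update_comm hji, update_idem, update_self, update_idem] at this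
      simp only [List.reverse_cons, List.append_assoc,
        List.cons_append, List.nil_append] at this ⊢
      exact this

/-- Move all symbols from the first scratch stack to the main stack and to the second one. -/
def flushBoth : Prog :=
  rep (.pop (some 1) (fun v x => (x, v.2)) (.branch (fun v => v.1.isSome)
    (.push (some 0) (fun v => v.1.getD false) (.push (some 2) (fun v => v.1.getD false)
      (goto fun _ => true))) (goto fun _ => false)))

theorem run_flushBoth (m a b c : List Bool) :
    Run flushBoth (stks m a b c) (stks (a.reverse ++ m) [] (a.reverse ++ b) c)
      (2 * a.length + 1) := by
  induction a generalizing m b with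
  | nil => exact .loop_false (.intro fun v => by simp)
  | cons x a ih =>
    have h := run_rep_true (S := stks m (x :: a) b c) (.intro fun v => by simp)
      (ih (x :: m) (x :: b))
    simp only [List.length_cons, List.reverse_cons, List.append_assoc, List.cons_append,
      List.nil_append]
    exact h.mono (by omega)

/-- Empty the first scratch stack. -/
def clear : Prog :=
  rep (.pop (some 1) (fun v x => (x, v.2)) (goto fun v => v.1.isSome))

theorem run_clear (m a b c : List Bool) :
    Run clear (stks m a b c) (stks m [] b c) (2 * a.length + 1) := by
  induction a with
  | nil => exact .loop_false (.intro fun v => by simp)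
  | cons x a ih =>
    exact (run_rep_true (.intro (S' := stks m a b c) fun v => by simp) ih).mono (by simp; omega)

/-- Remove a tree. -/
def drop : Prog := .seq read clear

theorem run_drop (x : Bin) (m : List Bool) :
    Run drop (stks (x.flat ++ m) [] [] []) (stks m [] [] []) (4 * x.size + 3) := by
  refine (Run.seq (run_read x m [] []) (run_clear _ _ _ _)).mono ?_
  simp [Bin.length_flat]; omega

/-- Duplicate a tree. -/
def dup : Prog := .seq read (.seq flushBoth (.seq (flush 2 1) (flush 1 0)))

theorem run_dup (x : Bin) (m : List Bool) :
    Run dup (stks (x.flat ++ m) [] [] []) (stks (x.flat ++ (x.flat ++ m)) [] [] [])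
      (8 * x.size + 5) := by
  have h2 := run_flushBoth m (x.flat.reverse ++ []) [] []
  have h3 := run_flush (i := 2) (j := 1) (by decide) x.flat (stks (x.flat ++ m) [] x.flat []) rfl
  have h4 := run_flush (i := 1) (j := 0) (by decide) x.flat.reverse
    (stks (x.flat ++ m) x.flat.reverse [] []) rfl
  simp at h2 h3 h4
  have h1 := run_read x m [] []
  rw [List.append_nil] at h1
  refine (Run.seq h1 (.seq h2 (.seq h3 h4))).mono ?_
  simp only [Bin.length_flat]; omega

/-- Exchange two trees. -/
def swap : Prog :=
  .seq read (.seq (flush 1 2) (.seq read (.seq (flush 2 3) (.seq (flush 3 0) (flush 1 0)))))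

theorem run_swap (x y : Bin) (m : List Bool) :
    Run swap (stks (x.flat ++ (y.flat ++ m)) [] [] []) (stks (y.flat ++ (x.flat ++ m)) [] [] [])
      (8 * x.size + 4 * y.size + 8) := by
  have h1 := run_read x (y.flat ++ m) [] []
  have h2 := run_flush (i := 1) (j := 2) (by decide) x.flat.reverse
    (stks (y.flat ++ m) x.flat.reverse [] []) rfl
  have h3 := run_read y m [] x.flat
  have h4 := run_flush (i := 2) (j := 3) (by decide) x.flat
    (stks m y.flat.reverse x.flat []) rfl
  have h5 := run_flush (i := 3) (j := 0) (by decide) x.flat.reverse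
    (stks m y.flat.reverse [] x.flat.reverse) rfl
  have h6 := run_flush (i := 1) (j := 0) (by decide) y.flat.reverse
    (stks (x.flat ++ m) y.flat.reverse [] []) rfl
  simp at h1 h2 h3 h4 h5 h6
  refine (Run.seq h1 (.seq h2 (.seq h3 (.seq h4 (.seq h5 h6))))).mono ?_
  simp [Bin.length_flat]; omega

/-- Compare the second and the third scratch stack; the first one is nonempty at the end if they
differ. -/
def compare : Prog :=
  rep (.pop (some 2) (fun v x => (x, v.2)) (.pop (some 3) (fun v x => (v.1, x, v.2.2))
    (.branch (fun v => v.1 = v.2.1) (goto fun v => v.1.isSome)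
      (.push (some 1) (fun _ => true) (goto fun _ => true)))))

/-- The number `k` counts the positions where the strings differ, those beyond the end of the
shorter one included. Its upper bound pays for clearing the marks afterwards. -/
theorem run_compare (m a b c : List Bool) :
    ∃ k, (k = 0 ↔ b = c) ∧ k ≤ b.length + c.length ∧ Run compare (stks m a b c) (stks m (List.replicate k true ++ a) [] [])
      (2 * b.length + 2 * c.length + 1) := by
  induction b generalizing a c with
  | nil =>
    induction c generalizing a with
    | nil => exact ⟨0, by simp, by simp, .loop_false (.intro fun v => by simp)⟩
    | cons y c ih =>
      obtain ⟨k, -, hl, h⟩ := ih (true :: a)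
      refine ⟨k + 1, by simp, by simp at hl ⊢; omega, (run_rep_true (.intro (S' := stks m (true :: a) [] c) fun v => ?_)
        (n := _) (S'' := _) (by rw [List.replicate_succ', List.append_assoc]; exact h)).mono (by simp; omega)⟩
      simp
  | cons x b ih =>
    cases c with
    | nil =>
      obtain ⟨k, -, hl, h⟩ := ih (true :: a) []
      refine ⟨k + 1, by simp, by simp at hl ⊢; omega, (run_rep_true (.intro (S' := stks m (true :: a) b []) fun v => ?_)
        (n := _) (S'' := _) (by rw [List.replicate_succ', List.append_assoc]; exact h)).mono (by simp; omega)⟩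
      simp
    | cons y c =>
      by_cases hxy : x = y
      · subst hxy
        obtain ⟨k, hk, hl, h⟩ := ih a c
        refine ⟨k, by simpa using hk, by simp; omega, (run_rep_true (.intro (S' := stks m a b c) fun v => ?_)
          h).mono (by simp; omega)⟩
        simp
      · obtain ⟨k, -, hl, h⟩ := ih (true :: a) c
        refine ⟨k + 1, by simp [hxy], by simp; omega, (run_rep_true (.intro (S' := stks m (true :: a) b c)
          fun v => ?_) (n := _) (S'' := _)
          (by rw [List.replicate_succ', List.append_assoc]; exact h)).mono (by simp; omega)⟩
        simp [hxy]

/-- Push a tree. -/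
def const : Bin → Prog
  | .leaf => push false
  | .node x y => .seq (const y) (.seq (const x) (push true))

theorem run_const (x : Bin) (m : List Bool) :
    Run (const x) (stks m [] [] []) (stks (x.flat ++ m) [] [] []) x.size := by
  induction x generalizing m with
  | leaf => exact run_push _ _ _ _ _
  | node x y ihx ihy =>
    have h := Run.seq (ihy m) (.seq (ihx _) (run_push true _ _ _ _))
    rw [← List.append_assoc] at h
    exact h.mono (by simp only [Bin.size]; omega)

/-- Decide whether two trees are equal. -/
def eqTest : Prog :=
  .seq read (.seq (flush 1 2) (.seq read (.seq (flush 1 3) (.seq compare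
    (.ite (.peek (some 1) (fun v x => (x, v.2)) (goto fun v => v.1.isSome))
      (.seq clear (const (Bin.ofBool false))) (const (Bin.ofBool true)))))))

theorem run_eqTest (x y : Bin) (m : List Bool) :
    Run eqTest (stks (x.flat ++ (y.flat ++ m)) [] [] [])
      (stks ((Bin.ofBool (decide (x = y))).flat ++ m) [] [] [])
      (11 * x.size + 11 * y.size + 22) := by
  have h1 := run_read x (y.flat ++ m) [] []
  have h2 := run_flush (i := 1) (j := 2) (by decide) x.flat.reverse
    (stks (y.flat ++ m) x.flat.reverse [] []) rfl
  have h3 := run_read y m [] x.flat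
  have h4 := run_flush (i := 1) (j := 3) (by decide) y.flat.reverse
    (stks m y.flat.reverse x.flat []) rfl
  obtain ⟨k, hk, hl, h5⟩ := run_compare m [] x.flat y.flat
  simp at h1 h2 h3 h4 h5
  rw [Bin.flat_inj] at hk
  have h6 : Run (.ite (.peek (some 1) (fun v x => (x, v.2)) (goto fun v => v.1.isSome))
      (.seq clear (const (Bin.ofBool false))) (const (Bin.ofBool true)))
      (stks m (List.replicate k true) [] [])
      (stks ((Bin.ofBool (decide (x = y))).flat ++ m) [] [] []) (2 * k + 7) := by
    rcases k with _ | k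
    · rw [decide_eq_true (hk.1 rfl)]
      refine (Run.ite_false (S' := stks m [] [] []) (.intro fun v => ?_) (run_const _ _)).mono ?_
      · simp
      · simp [Bin.size, Bin.ofBool]
    · rw [decide_eq_false fun h => by simpa using hk.2 h]
      refine (Run.ite_true (S' := stks m (List.replicate (k + 1) true) [] []) (.intro fun v => ?_)
        (.seq (run_clear _ _ _ _) (run_const _ _))).mono ?_
      · simp [List.replicate_succ]
      · simp [Bin.size, Bin.ofBool]
  refine (Run.seq h1 (.seq h2 (.seq h3 (.seq h4 (.seq h5 h6))))).mono ?_
  simp only [Bin.length_flat] at *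
  omega

/-- Decide whether a tree is a leaf. -/
def leafTest : Prog :=
  .ite (.peek (some 0) (fun v x => (x, v.2)) (goto fun v => v.1.getD false))
    (.seq drop (const (Bin.ofBool false))) (.seq drop (const (Bin.ofBool true)))

theorem run_leafTest (x : Bin) (m : List Bool) :
    Run leafTest (stks (x.flat ++ m) [] [] [])
      (stks ((Bin.ofBool (decide (x = .leaf))).flat ++ m) [] [] []) (4 * x.size + 9) := by
  cases x with
  | leaf =>
    refine (Run.ite_false (S' := stks (Bin.leaf.flat ++ m) [] [] []) (.intro fun v => ?_)
      (.seq (run_drop _ _) (run_const _ _))).mono ?_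
    · simp [Bin.flat]
    · simp [Bin.size, Bin.ofBool]
  | node x y =>
    refine (Run.ite_true (S' := stks ((Bin.node x y).flat ++ m) [] [] []) (.intro fun v => ?_)
      (.seq (run_drop _ _) (run_const _ _))).mono ?_
    · simp [Bin.flat]
    · simp [Bin.size, Bin.ofBool]

/-- A block that removes a truth value and exits with it. -/
def popBool : Block Bool :=
  .pop (some 0) (fun v _ => v) (.pop (some 0) (fun v x => (x, v.2)) (.pop (some 0) (fun v _ => v)
    (.pop (some 0) (fun v _ => v) (.pop (some 0) (fun v _ => v)
      (goto fun v => v.1.getD false)))))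

theorem popBool_exits (x : Bool) (m : List Bool) :
    popBool.Exits x (stks ((Bin.ofBool x).flat ++ m) [] [] []) (stks m [] [] []) :=
  .intro fun v => by cases x <;> simp [popBool, Bin.ofBool, Bin.flat]

/-- Remove a symbol. -/
def pop : Prog := .blk (.pop (some 0) (fun v _ => v) (goto fun _ => ()))

theorem run_pop (x : Bool) (m a b c : List Bool) :
    Run pop (stks (x :: m) a b c) (stks m a b c) 1 :=
  .blk (.intro fun v => by simp)

end Prog
end

section

open Turing Function

/-- Coefficients are natural numbers, so polynomials are monotone; this is what lets time bounds be
composed. -/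
theorem eval_le_eval (q : Polynomial ℕ) {m n : ℕ} (h : m ≤ n) : q.eval m ≤ q.eval n := by
  rw [Polynomial.eval_eq_sum_range, Polynomial.eval_eq_sum_range]
  exact Finset.sum_le_sum fun i _ => Nat.mul_le_mul_left _ (Nat.pow_le_pow_left h i)

/-! ### Polynomial-time transformations of trees -/

/-- Some program turns, for all `i`, the tree `e i` into `e' i`, in time polynomial in the size of
`e i`; the size of `e' i` is bounded by a polynomial also. -/
def Computes {ι : Type} (e e' : ι → Bin) : Prop :=
  ∃ (p : Prog) (q : Polynomial ℕ), ∀ i, (e' i).size ≤ q.eval (e i).size ∧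
    ∀ r, Run p (stks ((e i).flat ++ r) [] [] []) (stks ((e' i).flat ++ r) [] [] [])
      (q.eval (e i).size)

namespace Computes

variable {ι κ : Type} {e e' e'' e₁ e₂ : ι → Bin}

theorem reindex (h : Computes e e') (g : κ → ι) : Computes (fun i => e (g i)) fun i => e' (g i) := by
  obtain ⟨p, q, h⟩ := h
  exact ⟨p, q, fun i => h (g i)⟩

theorem refl (e : ι → Bin) : Computes e e :=
  ⟨.skip, .X + 1, fun i => ⟨by simp, fun r => (Prog.run_skip _).mono (by simp)⟩⟩

/-- The second program runs on `e' i`, whose size is controlled by the size bound that is part of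
`Computes`; hence the composite polynomial `q'.comp q`. -/
theorem trans (h : Computes e e') (h' : Computes e' e'') : Computes e e'' := by
  obtain ⟨p, q, h⟩ := h
  obtain ⟨p', q', h'⟩ := h'
  refine ⟨.seq p p', q + q'.comp q, fun i => ?_⟩
  have := eval_le_eval q' (h i).1
  simp only [Polynomial.eval_add, Polynomial.eval_comp]
  exact ⟨by linarith [(h' i).1], fun r => (((h i).2 r).seq ((h' i).2 r)).mono (by omega)⟩

theorem const (e : ι → Bin) (x : Bin) : Computes e fun _ => x := by
  refine ⟨.seq .drop (.const x), 4 * .X + 3 + (x.size : Polynomial ℕ), fun i => ?_⟩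
  simp only [Polynomial.eval_add, Polynomial.eval_mul, Polynomial.eval_X, Polynomial.eval_natCast,
    Polynomial.eval_ofNat, Nat.cast_id]
  exact ⟨by omega, fun r => ((Prog.run_drop _ _).seq (Prog.run_const _ _)).mono (by simp)⟩

/-- The input is duplicated because both programs need it. The right subtree is computed first,
since the left one has to end up above it; one more symbol then completes the node. -/
theorem node (h₁ : Computes e e₁) (h₂ : Computes e e₂) :
    Computes e fun i => .node (e₁ i) (e₂ i) := by
  obtain ⟨p₁, q₁, h₁⟩ := h₁
  obtain ⟨p₂, q₂, h₂⟩ := h₂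
  refine ⟨.seq .dup (.seq p₂ (.seq .swap (.seq p₁ (.push true)))),
    12 * .X + 14 + 9 * q₂ + q₁, fun i => ?_⟩
  simp only [Polynomial.eval_add, Polynomial.eval_mul, Polynomial.eval_X, Polynomial.eval_ofNat]
  have := (h₁ i).1
  have := (h₂ i).1
  refine ⟨by simp only [Bin.size]; omega, fun r => ?_⟩
  have h := (Prog.run_dup (e i) r).seq (((h₂ i).2 _).seq ((Prog.run_swap _ _ _).seq
    (((h₁ i).2 _).seq (Prog.run_push true _ [] [] []))))
  rw [← List.append_assoc] at h
  exact h.mono (by omega)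

/-- Removing the first symbol of a node leaves its two subtrees on the stack, one after the other.
-/
theorem left {a b : ι → Bin} : Computes (fun i => .node (a i) (b i)) a := by
  refine ⟨.seq .pop (.seq .swap .drop), 12 * .X + 12, fun i => ?_⟩
  simp only [Polynomial.eval_add, Polynomial.eval_mul, Polynomial.eval_X, Polynomial.eval_ofNat,
    Bin.size]
  refine ⟨by omega, fun r => ?_⟩
  simp only [Bin.flat, List.cons_append, List.append_assoc]
  exact ((Prog.run_pop _ _ _ _ _).seq ((Prog.run_swap _ _ _).seq (Prog.run_drop _ _))).mono
    (by omega)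

theorem right {a b : ι → Bin} : Computes (fun i => .node (a i) (b i)) b := by
  refine ⟨.seq .pop .drop, 12 * .X + 12, fun i => ?_⟩
  simp only [Polynomial.eval_add, Polynomial.eval_mul, Polynomial.eval_X, Polynomial.eval_ofNat,
    Bin.size]
  refine ⟨by omega, fun r => ?_⟩
  simp only [Bin.flat, List.cons_append, List.append_assoc]
  exact ((Prog.run_pop _ _ _ _ _).seq (Prog.run_drop _ _)).mono (by omega)

theorem leafTest : Computes e fun i => .ofBool (decide (e i = .leaf)) := by
  refine ⟨.leafTest, 4 * .X + 9, fun i => ?_⟩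
  simp only [Polynomial.eval_add, Polynomial.eval_mul, Polynomial.eval_X, Polynomial.eval_ofNat,
    Bin.size_ofBool]
  exact ⟨by omega, fun r => Prog.run_leafTest _ _⟩

theorem eqTest {a b : ι → Bin} :
    Computes (fun i => .node (a i) (b i)) fun i => .ofBool (decide (a i = b i)) := by
  refine ⟨.seq .pop .eqTest, 11 * .X + 23, fun i => ?_⟩
  simp only [Polynomial.eval_add, Polynomial.eval_mul, Polynomial.eval_X, Polynomial.eval_ofNat,
    Bin.size_ofBool, Bin.size]
  refine ⟨by omega, fun r => ?_⟩
  simp only [Bin.flat, List.cons_append, List.append_assoc]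
  exact ((Prog.run_pop _ _ _ _ _).seq (Prog.run_eqTest _ _ _)).mono (by omega)

/-- Each branch is only required to work on the inputs for which it is taken, hence the subtypes. -/
theorem ite {c : ι → Bool} (hc : Computes e fun i => .ofBool (c i))
    (h₁ : Computes (fun i : {i // c i = true} => e i) fun i => e' i)
    (h₂ : Computes (fun i : {i // c i = false} => e i) fun i => e' i) : Computes e e' := by
  obtain ⟨p, q, h⟩ := hc
  obtain ⟨p₁, q₁, h₁⟩ := h₁
  obtain ⟨p₂, q₂, h₂⟩ := h₂
  refine ⟨.seq (.seq .dup p) (.ite Prog.popBool p₁ p₂), 8 * .X + 6 + q + q₁ + q₂, fun i => ?_⟩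
  simp only [Polynomial.eval_add, Polynomial.eval_mul, Polynomial.eval_X, Polynomial.eval_ofNat]
  have hd := fun r => (Prog.run_dup (e i) r).seq ((h i).2 _)
  cases hi : c i with
  | true =>
    have := (h₁ ⟨i, hi⟩).1
    refine ⟨by dsimp only at this; omega, fun r => ((hd r).seq (.ite_true ?_
      ((h₁ ⟨i, hi⟩).2 r))).mono (by dsimp only; omega)⟩
    simp only [hi]
    exact Prog.popBool_exits _ _
  | false =>
    have := (h₂ ⟨i, hi⟩).1
    refine ⟨by dsimp only at this; omega, fun r => ((hd r).seq (.ite_false ?_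
      ((h₂ ⟨i, hi⟩).2 r))).mono (by dsimp only; omega)⟩
    simp only [hi]
    exact Prog.popBool_exits _ _

/-- Iteration. The states that are reached from `i` are `s i 0`, …, `s i (n i)`. -/
theorem loop {s : ι → ℕ → Bin} {n : ι → ℕ}
    (hc : Computes (fun x : {x : ι × ℕ // x.2 ≤ n x.1} => s x.1.1 x.1.2)
      fun x => .ofBool (decide (x.1.2 < n x.1.1)))
    (hs : Computes (fun x : {x : ι × ℕ // x.2 < n x.1} => s x.1.1 x.1.2)
      fun x => s x.1.1 (x.1.2 + 1))
    (hn : ∃ q : Polynomial ℕ, ∀ i, n i ≤ q.eval (s i 0).size ∧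
      ∀ k ≤ n i, (s i k).size ≤ q.eval (s i 0).size) :
    Computes (fun i => s i 0) fun i => s i (n i) := by
  obtain ⟨p, q, h⟩ := hc
  obtain ⟨p', q', h'⟩ := hs
  obtain ⟨q'', hn⟩ := hn
  -- The block of a loop can only pop a truth value, so the test runs on a copy of the state once
  -- before the loop and again at the end of each pass.
  refine ⟨.seq (.seq .dup p) (.loop Prog.popBool (.seq p' (.seq .dup p))),
    q'' + (q'' + 1) * (8 * q'' + 6 + q.comp q'' + q'.comp q''), fun i => ⟨?_, fun r => ?_⟩⟩
  · have := (hn i).2 (n i) le_rfl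
    simp only [Polynomial.eval_add]
    omega
  have hd : ∀ k ≤ n i, Run (.seq .dup p) (stks ((s i k).flat ++ r) [] [] [])
      (stks ((Bin.ofBool (decide (k < n i))).flat ++ ((s i k).flat ++ r)) [] [] [])
      (8 * q''.eval (s i 0).size + 5 + q.eval (q''.eval (s i 0).size)) := by
    intro k hk
    have h1 := (hn i).2 k hk
    refine ((Prog.run_dup (s i k) r).seq ((h ⟨(i, k), hk⟩).2 _)).mono ?_
    have := eval_le_eval q h1
    dsimp only
    omega
  -- The cost of one pass: popping the truth value, the step itself, and the test on a copy, for
  -- states of size at most `q''.eval (s i 0).size`.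
  set B := 8 * q''.eval (s i 0).size + 6 + q.eval (q''.eval (s i 0).size) +
    q'.eval (q''.eval (s i 0).size) with hB
  have key : ∀ m k, k + m = n i → Run (.loop Prog.popBool (.seq p' (.seq .dup p)))
      (stks ((Bin.ofBool (decide (k < n i))).flat ++ ((s i k).flat ++ r)) [] [] [])
      (stks ((s i (n i)).flat ++ r) [] [] []) (m * B + 1) := by
    intro m
    induction m with
    | zero =>
      intro k hk
      obtain rfl : k = n i := by omega
      rw [decide_eq_false (lt_irrefl _)]
      exact (Run.loop_false (Prog.popBool_exits _ _)).mono (by omega)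
    | succ m ih =>
      intro k hk
      rw [decide_eq_true (by omega : k < n i)]
      refine (Run.loop_true (Prog.popBool_exits _ _)
        (((h' ⟨(i, k), by dsimp only; omega⟩).2 r).seq (hd (k + 1) (by omega)))
        (ih (k + 1) (by omega))).mono ?_
      have := eval_le_eval q' ((hn i).2 k (by omega))
      have e : (m + 1) * B = m * B + B := by ring
      rw [e]
      dsimp only
      omega
  refine ((hd 0 (Nat.zero_le _)).seq (key (n i) 0 (by omega))).mono ?_
  simp only [Polynomial.eval_add, Polynomial.eval_mul, Polynomial.eval_comp, Polynomial.eval_ofNat,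
    Polynomial.eval_one]
  rw [← hB]
  have : n i * B ≤ q''.eval (s i 0).size * B := Nat.mul_le_mul_right _ (hn i).1
  rw [add_mul, one_mul]
  omega

end Computes

/-! ### Polynomial-time functions -/

/-- Types whose elements are represented by trees. -/
class TreeRep (α : Type) where
  enc : α → Bin
  enc_injective : Injective enc

open TreeRep

/-- The size of the representation of an object. -/
def repSize {α : Type} [TreeRep α] (a : α) : ℕ := (enc a).size

instance : TreeRep Bool := ⟨Bin.ofBool, Bin.ofBool_injective⟩

instance {α β : Type} [TreeRep α] [TreeRep β] : TreeRep (α × β) where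
  enc x := .node (enc x.1) (enc x.2)
  enc_injective x y h := by
    simp only [Bin.node.injEq] at h
    exact Prod.ext (enc_injective h.1) (enc_injective h.2)

/-- Lists as trees. -/
def encTreeList {α : Type} [TreeRep α] : List α → Bin
  | [] => .leaf
  | a :: l => .node (enc a) (encTreeList l)

instance {α : Type} [TreeRep α] : TreeRep (List α) where
  enc := encTreeList
  enc_injective l := by
    induction l with
    | nil => intro l' h; cases l' <;> simp_all [encTreeList]
    | cons a l ih =>
      intro l' h
      cases l' with
      | nil => simp [encTreeList] at h
      | cons b l' =>
        simp only [encTreeList, Bin.node.injEq] at h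
        rw [enc_injective h.1, ih h.2]

section
variable {α β γ δ : Type} [TreeRep α] [TreeRep β] [TreeRep γ] [TreeRep δ]

theorem enc_nil : enc ([] : List α) = .leaf := rfl
theorem enc_bool (b : Bool) : enc b = Bin.ofBool b := rfl

theorem repSize_pos (a : α) : 0 < repSize a := Bin.size_pos _
@[simp] theorem repSize_pair (a : α) (b : β) : repSize (a, b) = repSize a + repSize b + 1 := rfl
@[simp] theorem repSize_nil : repSize ([] : List α) = 1 := rfl
@[simp] theorem repSize_cons (a : α) (l : List α) : repSize (a :: l) = repSize a + repSize l + 1 :=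
  rfl
@[simp] theorem repSize_bool (b : Bool) : repSize b = 5 := Bin.size_ofBool b

theorem repSize_append (l l' : List α) : repSize (l ++ l') + 1 = repSize l + repSize l' := by
  induction l with
  | nil => simp; omega
  | cons a l ih => simp; omega

theorem repSize_reverse (l : List α) : repSize l.reverse = repSize l := by
  induction l with
  | nil => rfl
  | cons a l ih =>
    have := repSize_append l.reverse [a]
    simp at this ⊢
    omega

theorem length_le_repSize (l : List α) : l.length ≤ repSize l := by
  induction l with
  | nil => simp
  | cons a l ih => simp; omega

theorem repSize_le_of_mem {a : α} {l : List α} (h : a ∈ l) : repSize a ≤ repSize l := by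
  induction l with
  | nil => simp at h
  | cons b l ih =>
    rcases List.mem_cons.1 h with rfl | h
    · simp; omega
    · have := ih h
      simp; omega

theorem repSize_sublist {l l' : List α} (h : l.Sublist l') : repSize l ≤ repSize l' := by
  induction h with
  | slnil => exact le_rfl
  | cons a _ ih => simp; omega
  | cons_cons a _ ih => simp; omega

/-- Functions that are computable in polynomial time. -/
@[fun_prop]
def PolyTime (f : α → β) : Prop := Computes enc fun a => enc (f a)

-- Closure properties of polynomial-time functions on pairs, truth values and lists

namespace PolyTime

@[fun_prop] theorem id : PolyTime fun a : α => a := Computes.refl _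

@[fun_prop] theorem const (b : β) : PolyTime fun _ : α => b := Computes.const _ _

@[fun_prop] theorem comp {f : β → γ} {g : α → β} (hf : PolyTime f) (hg : PolyTime g) :
    PolyTime fun a => f (g a) := Computes.trans hg (hf.reindex g)

@[fun_prop] theorem pair {f : α → β} {g : α → γ} (hf : PolyTime f) (hg : PolyTime g) :
    PolyTime fun a => (f a, g a) := Computes.node hf hg

@[fun_prop] theorem fst {f : α → β × γ} (hf : PolyTime f) : PolyTime fun a => (f a).1 :=
  Computes.trans hf (Computes.left (b := fun a => enc (f a).2))

@[fun_prop] theorem snd {f : α → β × γ} (hf : PolyTime f) : PolyTime fun a => (f a).2 :=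
  Computes.trans hf (Computes.right (a := fun a => enc (f a).1))

@[fun_prop] theorem cond {c : α → Bool} {f g : α → β} (hc : PolyTime c) (hf : PolyTime f)
    (hg : PolyTime g) : PolyTime fun a => bif c a then f a else g a := by
  refine Computes.ite hc ?_ ?_
  · have : ∀ i : {i // c i = true}, enc (bif c i then f i else g i) = enc (f i) := fun i => by
      rw [i.2]; rfl
    simp only [this]
    exact Computes.reindex hf Subtype.val
  · have : ∀ i : {i // c i = false}, enc (bif c i then f i else g i) = enc (g i) := fun i => by
      rw [i.2]; rfl
    simp only [this]
    exact Computes.reindex hg Subtype.val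

@[fun_prop] theorem and {f g : α → Bool} (hf : PolyTime f) (hg : PolyTime g) :
    PolyTime fun a => f a && g a := by
  have : PolyTime fun a => bif f a then g a else false := by fun_prop
  convert this using 2 with a
  cases f a <;> rfl

@[fun_prop] theorem or {f g : α → Bool} (hf : PolyTime f) (hg : PolyTime g) :
    PolyTime fun a => f a || g a := by
  have : PolyTime fun a => bif f a then true else g a := by fun_prop
  convert this using 2 with a
  cases f a <;> rfl

@[fun_prop] theorem not {f : α → Bool} (hf : PolyTime f) : PolyTime fun a => !f a := by
  have : PolyTime fun a => bif f a then false else true := by fun_prop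
  convert this using 2 with a
  cases f a <;> rfl

-- Representations are injective, so equality of objects is equality of trees.
@[fun_prop] theorem decide_eq [DecidableEq β] {f g : α → β} (hf : PolyTime f) (hg : PolyTime g) :
    PolyTime fun a => decide (f a = g a) := by
  have h := Computes.trans (Computes.node hf hg) Computes.eqTest
  unfold PolyTime
  simpa only [enc_bool, enc_injective.eq_iff] using h

@[fun_prop] theorem cons {f : α → β} {g : α → List β} (hf : PolyTime f) (hg : PolyTime g) :
    PolyTime fun a => f a :: g a := Computes.node hf hg

/-- Pattern matching costs nothing beyond the test for a leaf: if `f a = x :: l`, then the input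
paired with `f a` is, as a tree, the representation of `(a, x, l)`. -/
theorem list_casesOn {f : α → List β} {g : α → γ} {h : α × β × List β → γ} {k : α → γ}
    (hf : PolyTime f) (hg : PolyTime g) (hh : PolyTime h) (h_nil : ∀ a, f a = [] → k a = g a)
    (h_cons : ∀ a x l, f a = x :: l → k a = h (a, x, l)) : PolyTime k := by
  have hc : Computes (fun a => enc a) fun a => Bin.ofBool (decide (f a = [])) := by
    have h := Computes.trans hf Computes.leafTest
    have e : ∀ a, enc (f a) = .leaf ↔ f a = [] := fun a => by
      rw [← enc_nil (α := β), enc_injective.eq_iff]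
    convert h using 3 with a
    exact decide_eq_decide.2 (e a).symm
  refine Computes.ite hc ?_ ?_
  · have : ∀ a : {a // decide (f a = []) = true}, enc (k a) = enc (g a) := fun a => by
      rw [h_nil _ (of_decide_eq_true a.2)]
    simp only [this]
    exact Computes.reindex hg Subtype.val
  · have : ∀ a : {a // decide (f a = []) = false}, ∃ x l, f a = x :: l := fun a =>
      List.exists_cons_of_ne_nil (of_decide_eq_false a.2)
    choose x l hl using this
    have e1 : ∀ a : {a // decide (f a = []) = false}, enc (k a) = enc (h (a.1, x a, l a)) := fun a => by rw [h_cons _ _ _ (hl a)]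
    have e2 : ∀ a : {a // decide (f a = []) = false},
        Bin.node (enc a.1) (enc (f a)) = enc (a.1, x a, l a) := fun a => by rw [hl a]; rfl
    simp only [e1]
    refine Computes.trans (Computes.node (Computes.refl _) (Computes.reindex hf Subtype.val)) ?_
    simp only [e2]
    exact Computes.reindex hh fun a => (a.1, x a, l a)

@[fun_prop] theorem isEmpty {f : α → List β} (hf : PolyTime f) : PolyTime fun a => (f a).isEmpty :=
  list_casesOn hf (const true) (const false) (fun a h => by simp [h]) fun a x l h => by simp [h]

@[fun_prop] theorem headD {f : α → List β} {g : α → β} (hf : PolyTime f) (hg : PolyTime g) :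
    PolyTime fun a => (f a).headD (g a) :=
  list_casesOn (h := fun x => x.2.1) hf hg (by fun_prop) (fun a h => by simp [h])
    fun a x l h => by simp [h]

@[fun_prop] theorem tail {f : α → List β} (hf : PolyTime f) : PolyTime fun a => (f a).tail :=
  list_casesOn (h := fun x => x.2.2) hf (const []) (by fun_prop) (fun a h => by simp [h])
    fun a x l h => by simp [h]

theorem repSize_le {f : α → β} (hf : PolyTime f) :
    ∃ q : Polynomial ℕ, ∀ a, repSize (f a) ≤ q.eval (repSize a) := by
  obtain ⟨p, q, h⟩ := hf
  exact ⟨q, fun a => (h a).1⟩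

/-- A fold is a loop over states made of the parameter, the remaining list and the accumulator,
which stops when the remaining list is empty. The accumulators that occur are the folds of the
prefixes of `f a`, so bounding these bounds all states. -/
theorem foldl_of_bound {f : α → List β} {g : α → γ} {h : α → γ → β → γ} (hf : PolyTime f)
    (hg : PolyTime g) (hh : PolyTime fun x : α × γ × β => h x.1 x.2.1 x.2.2)
    (hb : ∃ q : Polynomial ℕ, ∀ a l, l <+: f a →
      repSize (l.foldl (h a) (g a)) ≤ q.eval (repSize a)) :
    PolyTime fun a => (f a).foldl (h a) (g a) := by
  let s : α → ℕ → α × List β × γ := fun a k =>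
    (a, (f a).drop k, ((f a).take k).foldl (h a) (g a))
  have h0 : PolyTime fun a => s a 0 := by
    simp only [s, List.drop_zero, List.take_zero, List.foldl_nil]
    fun_prop
  obtain ⟨qf, hqf⟩ := hf.repSize_le
  obtain ⟨q, hb⟩ := hb
  have hl : Computes (fun a => enc (s a 0)) fun a => enc (s a (f a).length) := by
    refine Computes.loop (s := fun a k => enc (s a k)) (n := fun a => (f a).length) ?_ ?_ ?_
    · have hc : PolyTime fun x : α × List β × γ => !x.2.1.isEmpty := by fun_prop
      have e : ∀ x : {x : α × ℕ // x.2 ≤ (f x.1).length},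
          decide (x.1.2 < (f x.1.1).length) = !(s x.1.1 x.1.2).2.1.isEmpty := fun x => by
        simp only [s]
        rcases Nat.lt_or_ge x.1.2 (f x.1.1).length with h | h
        · simp [h]
        · rw [decide_eq_false (by omega), List.drop_eq_nil_of_le h]
          rfl
      have h := Computes.reindex hc
        fun x : {x : α × ℕ // x.2 ≤ (f x.1).length} => s x.1.1 x.1.2
      simp only [← e] at h
      exact h
    · have hst : PolyTime fun x : α × List β × γ => match x.2.1 with
          | [] => x
          | b :: l => (x.1, l, h x.1 x.2.2 b) := by
        have hh' : PolyTime fun x : (α × List β × γ) × β × List β => h x.1.1 x.1.2.2 x.2.1 :=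
          hh.comp (g := fun x : (α × List β × γ) × β × List β => (x.1.1, x.1.2.2, x.2.1))
            (by fun_prop)
        refine list_casesOn (f := fun x : α × List β × γ => x.2.1) (g := fun x => x)
          (h := fun x => (x.1.1, x.2.2, h x.1.1 x.1.2.2 x.2.1)) (by fun_prop) (by fun_prop)
          (by fun_prop) (fun a h => by simp [h]) fun a x l h => by simp [h]
      have e : ∀ x : {x : α × ℕ // x.2 < (f x.1).length}, s x.1.1 (x.1.2 + 1) =
          (match (s x.1.1 x.1.2).2.1 with
          | [] => s x.1.1 x.1.2
          | b :: l => ((s x.1.1 x.1.2).1, l, h (s x.1.1 x.1.2).1 (s x.1.1 x.1.2).2.2 b)) :=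
        fun x => by
          simp only [s]
          rw [List.drop_eq_getElem_cons x.2, List.take_succ_eq_append_getElem x.2,
            List.foldl_append]
          rfl
      have h := Computes.reindex hst
        fun x : {x : α × ℕ // x.2 < (f x.1).length} => s x.1.1 x.1.2
      simp only [← e] at h
      exact h
    -- One summand for each component of a state and 2 for the nodes that pair them. The polynomials
    -- are applied to the size of the initial state, which exceeds that of `a`.
    · refine ⟨.X + q + qf + 2, fun a => ?_⟩
      have e0 : repSize a ≤ (enc (s a 0)).size := by
        show repSize a ≤ repSize (s a 0)
        simp [s]; omega
      have e1 := hqf a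
      have e2 := length_le_repSize (f a)
      have e3 := eval_le_eval qf e0
      have e4 := eval_le_eval q e0
      simp only [Polynomial.eval_add, Polynomial.eval_X, Polynomial.eval_ofNat]
      refine ⟨by omega, fun k _ => ?_⟩
      have e5 := hb a _ (List.take_prefix k (f a))
      have e6 := repSize_sublist (List.drop_sublist k (f a))
      show repSize (s a k) ≤ _
      simp only [s, repSize_pair] at *
      omega
  have := Computes.trans h0 (Computes.trans hl
    (Computes.reindex (PolyTime.snd (PolyTime.snd PolyTime.id)) fun a => s a (f a).length))
  simp only [s, List.take_length] at this
  exact this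

/-- Folding a list, when each step increases the size by an amount that does not depend on the
accumulator. -/
theorem foldl {f : α → List β} {g : α → γ} {h : α → γ → β → γ} (hf : PolyTime f)
    (hg : PolyTime g) (hh : PolyTime fun x : α × γ × β => h x.1 x.2.1 x.2.2)
    (hb : ∃ q : Polynomial ℕ, ∀ a c b,
      repSize (h a c b) ≤ repSize c + q.eval (repSize a + repSize b)) :
    PolyTime fun a => (f a).foldl (h a) (g a) := by
  refine foldl_of_bound hf hg hh ?_
  obtain ⟨qf, hqf⟩ := hf.repSize_le
  obtain ⟨qg, hqg⟩ := hg.repSize_le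
  obtain ⟨q, hb⟩ := hb
  -- The size of the initial value, plus the number of steps times the largest increment; `qf`
  -- bounds both the length of the list and the size of its elements.
  refine ⟨qg + qf * q.comp (.X + qf), fun a l hl => ?_⟩
  have key : ∀ (l : List β) (c : γ), (∀ b ∈ l, b ∈ f a) → repSize (l.foldl (h a) c) ≤
      repSize c + l.length * q.eval (repSize a + qf.eval (repSize a)) := by
    intro l
    induction l with
    | nil => intro c _; simp
    | cons b l ih =>
      intro c hl
      have h1 := ih (h a c b) fun b hb => hl b (List.mem_cons_of_mem _ hb)
      have h2 := hb a c b
      have h3 := (repSize_le_of_mem (hl b List.mem_cons_self)).trans (hqf a)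
      have h4 := eval_le_eval q (Nat.add_le_add_left h3 (repSize a))
      rw [List.foldl_cons, List.length_cons, add_mul, one_mul]
      omega
  have h1 := key l (g a) fun b hb => hl.subset hb
  have h2 := hqg a
  have h3 := (hl.length_le.trans (length_le_repSize _)).trans (hqf a)
  simp only [Polynomial.eval_add, Polynomial.eval_mul, Polynomial.eval_comp, Polynomial.eval_X]
  have h4 := Nat.mul_le_mul_right (q.eval (repSize a + qf.eval (repSize a))) h3
  omega

@[fun_prop] theorem reverse {f : α → List β} (hf : PolyTime f) :
    PolyTime fun a => (f a).reverse := by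
  have : PolyTime fun a => (f a).foldl (fun l b => b :: l) [] :=
    foldl hf (const []) (by fun_prop) ⟨.X + 1, fun a c b => by simp; omega⟩
  simpa using this

theorem foldr {f : α → List β} {g : α → γ} {h : α → β → γ → γ} (hf : PolyTime f)
    (hg : PolyTime g) (hh : PolyTime fun x : α × β × γ => h x.1 x.2.1 x.2.2)
    (hb : ∃ q : Polynomial ℕ, ∀ a c b,
      repSize (h a b c) ≤ repSize c + q.eval (repSize a + repSize b)) :
    PolyTime fun a => (f a).foldr (h a) (g a) := by
  have : PolyTime fun a => (f a).reverse.foldl (fun c b => h a b c) (g a) :=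
    foldl hf.reverse hg
      (hh.comp (g := fun x : α × γ × β => (x.1, x.2.2, x.2.1)) (by fun_prop)) hb
  simpa using this

@[fun_prop] theorem map {f : α → List β} {h : α → β → γ} (hf : PolyTime f)
    (hh : PolyTime fun x : α × β => h x.1 x.2) : PolyTime fun a => (f a).map (h a) := by
  have : PolyTime fun a => (f a).foldr (fun b c => h a b :: c) [] := by
    refine foldr hf (const []) ?_ ?_
    · exact cons (hh.comp (g := fun x : α × β × List γ => (x.1, x.2.1)) (by fun_prop))
        (by fun_prop)
    · obtain ⟨q, hq⟩ := hh.repSize_le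
      refine ⟨q.comp (.X + 1) + 1, fun a c b => ?_⟩
      have := hq (a, b)
      simp at this ⊢
      omega
  simpa only [List.foldr_cons_eq_append, List.append_nil] using this

@[fun_prop] theorem append {f g : α → List β} (hf : PolyTime f) (hg : PolyTime g) :
    PolyTime fun a => f a ++ g a := by
  have : PolyTime fun a => (f a).foldr (fun b c => b :: c) (g a) :=
    foldr hf hg (by fun_prop) ⟨.X + 1, fun a c b => by simp; omega⟩
  simpa using this

@[fun_prop] theorem flatMap {f : α → List β} {h : α → β → List γ} (hf : PolyTime f)
    (hh : PolyTime fun x : α × β => h x.1 x.2) : PolyTime fun a => (f a).flatMap (h a) := by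
  have : PolyTime fun a => (f a).foldr (fun b c => h a b ++ c) [] := by
    refine foldr hf (const []) ?_ ?_
    · exact append (hh.comp (g := fun x : α × β × List γ => (x.1, x.2.1)) (by fun_prop))
        (by fun_prop)
    · obtain ⟨q, hq⟩ := hh.repSize_le
      refine ⟨q.comp (.X + 1), fun a c b => ?_⟩
      have := hq (a, b)
      have := repSize_append (h a b) c
      simp at *
      omega
  convert this using 2 with a
  induction f a with
  | nil => rfl
  | cons b l ih => simp [ih]

@[fun_prop] theorem filter {f : α → List β} {h : α → β → Bool} (hf : PolyTime f)
    (hh : PolyTime fun x : α × β => h x.1 x.2) : PolyTime fun a => (f a).filter (h a) := by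
  have : PolyTime fun a => (f a).flatMap (fun b => bif h a b then [b] else []) := by fun_prop
  convert this using 2 with a
  induction f a with
  | nil => rfl
  | cons b l ih => cases e : h a b <;> simp [ih, e]

@[fun_prop] theorem any {f : α → List β} {h : α → β → Bool} (hf : PolyTime f)
    (hh : PolyTime fun x : α × β => h x.1 x.2) : PolyTime fun a => (f a).any (h a) := by
  have : PolyTime fun a => !((f a).filter (h a)).isEmpty := by fun_prop
  convert this using 2 with a
  induction f a with
  | nil => rfl
  | cons b l ih => cases e : h a b <;> simp [ih, e]

@[fun_prop] theorem all {f : α → List β} {h : α → β → Bool} (hf : PolyTime f)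
    (hh : PolyTime fun x : α × β => h x.1 x.2) : PolyTime fun a => (f a).all (h a) := by
  have : PolyTime fun a => !(f a).any (fun b => !h a b) := by fun_prop
  simpa only [List.not_any_eq_all_not, Bool.not_not] using this

/-- A function on a finite type can be given by cases. -/
theorem of_finite [Finite α] {h : α → β → γ} (hh : ∀ a, PolyTime (h a)) :
    PolyTime fun x : α × β => h x.1 x.2 := by
  classical
  have := Fintype.ofFinite α
  by_cases hα : Nonempty α
  swap
  · rw [not_nonempty_iff] at hα
    exact ⟨.skip, 0, fun x => hα.elim x.1⟩
  obtain ⟨a₀⟩ := hα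
  -- A chain of equality tests along `l` agrees with `h` on the elements of `l`; finally `l` is
  -- taken to list the whole type.
  have key : ∀ l : List α, ∃ k : α × β → γ, PolyTime k ∧ ∀ a ∈ l, ∀ b, k (a, b) = h a b := by
    intro l
    induction l with
    | nil => exact ⟨fun x => h a₀ x.2, (hh a₀).comp (by fun_prop), by simp⟩
    | cons a l ih =>
      obtain ⟨k, hk, h'⟩ := ih
      refine ⟨fun x => bif decide (x.1 = a) then h a x.2 else k x,
        cond (by fun_prop) ((hh a).comp (by fun_prop)) hk, fun a' ha' b => ?_⟩
      by_cases e : a' = a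
      · simp [e]
      · simp [e, h' a' ((List.mem_cons.1 ha').resolve_left e)]
  obtain ⟨k, hk, h'⟩ := key Finset.univ.toList
  convert hk using 2 with x
  exact (h' x.1 (by simp) x.2).symm

theorem of_finite_domain [Finite α] (f : α → β) : PolyTime f :=
  (of_finite (h := fun a (_ : Bool) => f a) fun _ => const _).comp
    (g := fun a => (a, true)) (by fun_prop)

end PolyTime

end

end

section

open Turing Function

open TreeRep

/-! ### Integers in base `-2` -/

/-- The value of a list of digits in base `-2`, the least significant digit first. -/
def negaVal : List Bool → ℤ
  | [] => 0
  | b :: l => (b.toNat : ℤ) - 2 * negaVal l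

/-- Put a digit in front of a list of digits without leading zeros. -/
def consDigit (b : Bool) (l : List Bool) : List Bool :=
  bif !b && l.isEmpty then [] else b :: l

/-- The digits of an integer in base `-2`, without leading zeros. -/
def negaDigits (z : ℤ) : List Bool :=
  if z = 0 then [] else decide (z % 2 = 1) :: negaDigits (-(z / 2))
-- The summand for the sign is needed for the passage from -1 to 1, which keeps the absolute value.
termination_by 2 * z.natAbs + (if z < 0 then 1 else 0)
decreasing_by split_ifs <;> omega

theorem negaVal_digits (z : ℤ) : negaVal (negaDigits z) = z := by
  induction z using negaDigits.induct with
  | case1 => simp [negaDigits, negaVal]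
  | case2 z hz ih =>
    rw [negaDigits, if_neg hz, negaVal, ih]
    rcases Int.emod_two_eq_zero_or_one z with h | h <;> simp [h] <;> omega

/-- This translates between operations on canonical digit lists and on integers. The case `b =
false`, `y = 0` is the one in which `consDigit` suppresses a leading zero. -/
theorem negaDigits_step (b : Bool) (y : ℤ) :
    negaDigits ((b.toNat : ℤ) - 2 * y) = consDigit b (negaDigits y) := by
  have h0 : negaDigits y = [] ↔ y = 0 := by
    rw [negaDigits]; split_ifs <;> simp_all
  cases b with
  | false =>
    by_cases hy : y = 0
    · subst hy; simp [consDigit, negaDigits]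
    · rw [negaDigits, if_neg (by simp; omega)]
      simp only [Bool.toNat_false, Nat.cast_zero, zero_sub, consDigit]
      rw [show -(-(2 * y) / 2) = y by omega, decide_eq_false (by omega)]
      cases h : negaDigits y with
      | nil => exact absurd (h0.1 h) hy
      | cons => rfl
  | true =>
    rw [negaDigits, if_neg (by simp; omega)]
    simp only [Bool.toNat_true, Nat.cast_one, consDigit]
    rw [show -((1 - 2 * y) / 2) = y by omega, decide_eq_true (by omega)]
    simp

theorem negaDigits_zero : negaDigits 0 = [] := by simp [negaDigits]

theorem natAbs_negaVal_lt (l : List Bool) : (negaVal l).natAbs < 2 ^ l.length := by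
  induction l with
  | nil => simp [negaVal]
  | cons b l ih =>
    rw [negaVal, List.length_cons, pow_succ]
    have := Bool.toNat_le b
    omega

/-- Each digit halves the absolute value, up to rounding. The constant 2 comes from -1, which is
written with two digits in base -2. -/
theorem length_negaDigits_le {z : ℤ} {n : ℕ} (h : z.natAbs ≤ 2 ^ n) :
    (negaDigits z).length ≤ n + 2 := by
  induction n generalizing z with
  | zero =>
    have : z = 0 ∨ z = 1 ∨ z = -1 := by omega
    rcases this with rfl | rfl | rfl
    · simp [negaDigits]
    · simp [negaDigits]
    · rw [negaDigits]; norm_num; rw [negaDigits]; norm_num; rw [negaDigits]; norm_num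
  | succ n ih =>
    rw [negaDigits]
    split_ifs with hz
    · simp
    · have : (-(z / 2)).natAbs ≤ 2 ^ n := by rw [pow_succ] at h; omega
      have := ih this
      simp only [List.length_cons]; omega

instance : TreeRep ℤ where
  enc z := enc (negaDigits z)
  enc_injective x y h := by rw [← negaVal_digits x, enc_injective h, negaVal_digits]

theorem repSize_digits (l : List Bool) : repSize l = 6 * l.length + 1 := by
  induction l with
  | nil => rfl
  | cons b l ih => simp [ih]; omega

theorem repSize_int (z : ℤ) : repSize z = 6 * (negaDigits z).length + 1 := repSize_digits _

theorem natAbs_le_of_repSize (z : ℤ) : z.natAbs ≤ 2 ^ (negaDigits z).length := by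
  conv_lhs => rw [← negaVal_digits z]
  exact (natAbs_negaVal_lt _).le

/-- Each digit contributes 6 to the size, and three digits more than the operands have together are
enough. -/
theorem repSize_add_le (x y : ℤ) : repSize (x + y) ≤ repSize x + repSize y + 18 := by
  have hx := natAbs_le_of_repSize x
  have hy := natAbs_le_of_repSize y
  simp only [repSize_int]
  have : (x + y).natAbs ≤ 2 ^ ((negaDigits x).length + (negaDigits y).length + 1) := by
    have h1 : 2 ^ (negaDigits x).length ≤ 2 ^ ((negaDigits x).length + (negaDigits y).length) :=
      Nat.pow_le_pow_right (by norm_num) (by omega)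
    have h2 : 2 ^ (negaDigits y).length ≤ 2 ^ ((negaDigits x).length + (negaDigits y).length) :=
      Nat.pow_le_pow_right (by norm_num) (by omega)
    rw [pow_succ]
    omega
  have := length_negaDigits_le this
  omega

theorem repSize_neg_le (x : ℤ) : repSize (-x) ≤ repSize x + 12 := by
  have hx := natAbs_le_of_repSize x
  rw [← Int.natAbs_neg] at hx
  have := length_negaDigits_le hx
  simp only [repSize_int]
  omega

theorem repSize_mul_le (x y : ℤ) : repSize (x * y) ≤ repSize x + repSize y + 12 := by
  have hx := natAbs_le_of_repSize x
  have hy := natAbs_le_of_repSize y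
  simp only [repSize_int]
  have : (x * y).natAbs ≤ 2 ^ ((negaDigits x).length + (negaDigits y).length) := by
    rw [Int.natAbs_mul, pow_add]
    exact Nat.mul_le_mul hx hy
  have := length_negaDigits_le this
  omega

/-- The carry that is represented by a pair of bits. -/
def carryVal (c : Bool × Bool) : ℤ := c.1.toNat - c.2.toNat

/-- Addition of two digits in base `-2` and a carry. -/
def fullAdd (x : Bool × Bool × Bool × Bool) : Bool × Bool × Bool :=
  let s : ℤ := x.1.toNat + x.2.1.toNat + carryVal x.2.2
  (decide (s % 2 = 1), decide (s < 0), decide (1 < s))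

/-- The sum of two digits and a carry from -1, 0, 1 lies between -1 and 3, and each such number is a
digit minus twice a carry of the same range. Finitely many cases. -/
theorem fullAdd_spec (x : Bool × Bool × Bool × Bool) :
    ((fullAdd x).1.toNat : ℤ) - 2 * carryVal (fullAdd x).2 =
      x.1.toNat + x.2.1.toNat + carryVal x.2.2 := by
  revert x; decide

/-- States of the addition algorithm: the remaining digits of the summands, the carry, and the
reversed list of the digits of the sum computed so far. -/
abbrev AddState := List Bool × List Bool × (Bool × Bool) × List Bool

def addStep (s : AddState) (_ : Bool) : AddState :=
  let r := fullAdd (s.1.headD false, s.2.1.headD false, s.2.2.1)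
  (s.1.tail, s.2.1.tail, r.2, r.1 :: s.2.2.2)

/-- The value of the output digits plus that of the remaining summands and carry. -/
def AddState.val (s : AddState) : ℤ :=
  negaVal s.2.2.2.reverse +
    (-2) ^ s.2.2.2.length * (negaVal s.1 + negaVal s.2.1 + carryVal s.2.2.1)

theorem negaVal_append (l l' : List Bool) :
    negaVal (l ++ l') = negaVal l + (-2) ^ l.length * negaVal l' := by
  induction l with
  | nil => simp [negaVal]
  | cons b l ih => simp only [List.cons_append, negaVal, ih, List.length_cons, pow_succ]; ring

theorem negaVal_headD_tail (l : List Bool) :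
    negaVal l = ((l.headD false).toNat : ℤ) - 2 * negaVal l.tail := by
  cases l <;> simp [negaVal]

/-- The invariant of addition: a step only shifts value from the summands and the carry to the
output. -/
theorem addStep_val (s : AddState) (x : Bool) : (addStep s x).val = s.val := by
  have h := fullAdd_spec (s.1.headD false, s.2.1.headD false, s.2.2.1)
  have h1 := negaVal_headD_tail s.1
  have h2 := negaVal_headD_tail s.2.1
  simp only [AddState.val, addStep, List.reverse_cons, negaVal_append, List.length_reverse,
    List.length_cons, pow_succ, negaVal]
  simp only at h
  rw [h1, h2]
  linear_combination (-2) ^ s.2.2.2.length * h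

theorem foldl_addStep_val (l : List Bool) (s : AddState) : (l.foldl addStep s).val = s.val := by
  induction l generalizing s with
  | nil => rfl
  | cons x l ih => rw [List.foldl_cons, ih, addStep_val]

theorem foldl_addStep_drop (l : List Bool) (s : AddState) :
    (l.foldl addStep s).1 = s.1.drop l.length ∧ (l.foldl addStep s).2.1 = s.2.1.drop l.length := by
  induction l generalizing s with
  | nil => simp
  | cons x l ih => simp [ih, addStep]

/-- When the summands are exhausted, a carry -1 yields the digit 1 and the carry 1, which in turn
yields the digit 1 and no carry. This is why addition takes two extra steps. -/
theorem carry_addStep (c : Bool × Bool) (o : List Bool) (x y : Bool) :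
    carryVal (addStep (addStep ([], [], c, o) x) y).2.2.1 = 0 := by
  simp only [addStep, List.headD_nil, List.tail_nil]
  revert c; decide

/-- The output of the addition has its most significant digit first, so this fold builds the number
from the top and drops leading zeros: the result is canonical. -/
theorem foldl_consDigit (o : List Bool) (y : ℤ) :
    o.foldl (fun l b => consDigit b l) (negaDigits y) =
      negaDigits (negaVal o.reverse + (-2) ^ o.length * y) := by
  induction o generalizing y with
  | nil => simp [negaVal]
  | cons b o ih =>
    rw [List.foldl_cons, ← negaDigits_step, ih]
    simp only [List.reverse_cons, negaVal_append, List.length_reverse, List.length_cons, negaVal,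
      pow_succ]
    congr 1
    ring

/-- Addition of lists of digits. -/
def addDigits (l l' : List Bool) : List Bool :=
  (((l ++ l') ++ [true, true]).foldl addStep (l, l', (false, false), [])).2.2.2.foldl
    (fun l b => consDigit b l) []

theorem addDigits_eq (l l' : List Bool) : addDigits l l' = negaDigits (negaVal l + negaVal l') := by
  have h1 := foldl_addStep_val ((l ++ l') ++ [true, true]) (l, l', (false, false), [])
  -- The list `l ++ l'` is only a clock: it is long enough for both summands to be used up.
  obtain ⟨h2, h3⟩ := foldl_addStep_drop (l ++ l') (l, l', (false, false), [])
  unfold addDigits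
  rw [List.foldl_append] at h1 ⊢
  generalize (l ++ l').foldl addStep (l, l', (false, false), []) = s at *
  obtain ⟨a, b, c, o⟩ := s
  obtain rfl : a = [] := h2.trans (by simp)
  obtain rfl : b = [] := h3.trans (by simp)
  have h5 := fun o => foldl_consDigit o 0
  simp only [negaDigits_zero, mul_zero, add_zero] at h5
  rw [h5]
  have h4 := carry_addStep c o true true
  simp only [List.foldl_cons, List.foldl_nil] at *
  have e : negaVal l + negaVal l' = AddState.val (l, l', (false, false), []) := by
    simp [AddState.val, negaVal, carryVal]
  rw [e, ← h1]
  rw [AddState.val, h4]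
  simp [addStep, negaVal]

-- Integer arithmetic in polynomial time

namespace PolyTime

variable {α β γ δ : Type} [TreeRep α] [TreeRep β] [TreeRep γ] [TreeRep δ]

@[fun_prop] theorem negaDigits {f : α → ℤ} (hf : PolyTime f) :
    PolyTime fun a => negaDigits (f a) := hf

theorem of_negaDigits {f : α → ℤ} (h : PolyTime fun a => ModASP.negaDigits (f a)) : PolyTime f := h

@[fun_prop] theorem consDigit {f : α → Bool} {g : α → List Bool} (hf : PolyTime f)
    (hg : PolyTime g) : PolyTime fun a => consDigit (f a) (g a) := by
  unfold ModASP.consDigit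
  fun_prop

@[fun_prop] theorem addStep {f : α → AddState} (hf : PolyTime f) (x : Bool) :
    PolyTime fun a => addStep (f a) x := by
  have := of_finite_domain fullAdd
  unfold ModASP.addStep
  fun_prop

@[fun_prop] theorem addDigits {f g : α → List Bool} (hf : PolyTime f) (hg : PolyTime g) :
    PolyTime fun a => addDigits (f a) (g a) := by
  have h : PolyTime fun a => ((f a ++ g a) ++ [true, true]).foldl ModASP.addStep
      (f a, g a, (false, false), []) := by
    refine foldl (h := fun _ => ModASP.addStep) (by fun_prop) (by fun_prop) ?_
      ⟨6, fun a ⟨u, v, c, o⟩ b => ?_⟩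
    · exact addStep (f := fun x : α × AddState × Bool => x.2.1) (by fun_prop) true
    · have h1 := repSize_sublist (List.tail_sublist u)
      have h2 := repSize_sublist (List.tail_sublist v)
      have h3 : ∀ c : Bool × Bool, repSize c = 11 := fun ⟨_, _⟩ => by simp
      simp only [ModASP.addStep, h3, repSize_pair, repSize_bool, repSize_cons,
        Polynomial.eval_ofNat]
      omega
  unfold ModASP.addDigits
  refine foldl (h := fun _ l b => ModASP.consDigit b l) (by fun_prop) (by fun_prop) (by fun_prop)
    ⟨6, fun a s b => ?_⟩
  unfold ModASP.consDigit
  cases h : !b && s.isEmpty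
  · simp; omega
  · simp

@[fun_prop] theorem int_add {f g : α → ℤ} (hf : PolyTime f) (hg : PolyTime g) :
    PolyTime fun a => f a + g a := by
  apply of_negaDigits
  have : PolyTime fun a => ModASP.addDigits (ModASP.negaDigits (f a)) (ModASP.negaDigits (g a)) := by
    fun_prop
  simpa only [addDigits_eq, negaVal_digits] using this

/-- Multiplication by the base puts a zero in front of the digits. -/
theorem neg_two_mul {f : α → ℤ} (hf : PolyTime f) : PolyTime fun a => -2 * f a := by
  apply of_negaDigits
  have : PolyTime fun a => ModASP.consDigit false (ModASP.negaDigits (f a)) := by fun_prop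
  simp only [← negaDigits_step] at this
  simpa using this

-- In base -2, negation reduces to a shift and an addition: `-z = z + -2 * z`.
@[fun_prop] theorem int_neg {f : α → ℤ} (hf : PolyTime f) : PolyTime fun a => -f a := by
  have : PolyTime fun a => f a + -2 * f a := int_add hf (neg_two_mul hf)
  convert this using 2 with a
  ring

@[fun_prop] theorem int_sub {f g : α → ℤ} (hf : PolyTime f) (hg : PolyTime g) :
    PolyTime fun a => f a - g a := by
  simpa only [sub_eq_add_neg] using int_add hf (int_neg hg)

@[fun_prop] theorem int_mul {f g : α → ℤ} (hf : PolyTime f) (hg : PolyTime g) :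
    PolyTime fun a => f a * g a := by
  have h2 : PolyTime fun x : ((α × Bool × ℤ)) => -2 * x.2.2 := neg_two_mul (by fun_prop)
  -- Horner's rule on the digits of `f a`. Each step adds at most the size of `g a` and a constant,
  -- as `foldr` requires; 100 is a generous value of the constant.
  have : PolyTime fun a => (ModASP.negaDigits (f a)).foldr
      (fun b z => (bif b then g a else 0) + -2 * z) 0 := by
    refine foldr (by fun_prop) (by fun_prop) (by fun_prop) ?_
    obtain ⟨q, hq⟩ := hg.repSize_le
    refine ⟨q + 100, fun a z b => ?_⟩
    have h1 := repSize_add_le (bif b then g a else 0) (-2 * z)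
    have h2 := repSize_mul_le (-2) z
    have h3 : repSize (-2 : ℤ) ≤ 30 := by
      rw [repSize_int]
      have := length_negaDigits_le (z := -2) (n := 1) (by norm_num)
      omega
    have h4 : repSize (bif b then g a else 0) ≤ q.eval (repSize a) + 1 := by
      have := hq a
      have h0 : repSize (0 : ℤ) = 1 := by rw [repSize_int, negaDigits_zero]; rfl
      cases b
      · simp [h0]
      · simp; omega
    have := eval_le_eval q (Nat.le_add_right (repSize a) (repSize b))
    simp only [Polynomial.eval_add, Polynomial.eval_ofNat]
    omega
  convert this using 2 with a
  have key : ∀ l : List Bool, negaVal l * g a =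
      l.foldr (fun b z => (bif b then g a else 0) + -2 * z) 0 := by
    intro l
    induction l with
    | nil => simp [negaVal]
    | cons b l ih =>
      rw [List.foldr_cons, ← ih, negaVal]
      cases b <;> simp <;> ring
  rw [← key, negaVal_digits]

end PolyTime

end

section

open Turing Function

open TreeRep

/-! ### Parsing -/

/-- A representation of the elements of a finite type. -/
@[reducible]
noncomputable def TreeRep.ofFinite (α : Type) [Finite α] : TreeRep α where
  enc a := enc (List.replicate (Finite.equivFin α a : ℕ) true)
  enc_injective a b h := by
    have := congrArg List.length (enc_injective h)
    simp only [List.length_replicate] at this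
    exact (Finite.equivFin α).injective (Fin.ext this)

noncomputable instance : TreeRep Tok := .ofFinite Tok

noncomputable instance : TreeRep (Option Tok) := .ofFinite (Option Tok)

/-- Syntax trees of normalized expressions: numbers, and lists of trees with a tag. -/
inductive Syn
  | int (z : ℤ)
  | node (t : Tok) (l : List Syn)

noncomputable instance : DecidableEq Syn := Classical.decEq _

-- Syntax trees as data

namespace Syn

/-- The tag of a syntax tree. -/
def tag : Syn → Option Tok
  | int _ => none
  | node t _ => some t

def args : Syn → List Syn
  | int _ => []
  | node _ l => l

def val : Syn → ℤ
  | int z => z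
  | node _ _ => 0

mutual
/-- Syntax trees as binary trees. -/
noncomputable def toBin : Syn → Bin
  | int z => .node (enc (none : Option Tok)) (enc z)
  | node t l => .node (enc (some t)) (toBinAll l)
noncomputable def toBinAll : List Syn → Bin
  | [] => .leaf
  | x :: l => .node x.toBin (toBinAll l)
end

mutual
theorem toBin_injective : ∀ x y : Syn, x.toBin = y.toBin → x = y
  | int z, int z', h => by
    simp only [toBin, Bin.node.injEq] at h
    rw [enc_injective h.2]
  | int z, node t l, h => by
    simp only [toBin, Bin.node.injEq] at h
    simpa using enc_injective h.1
  | node t l, int z, h => by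
    simp only [toBin, Bin.node.injEq] at h
    simpa using enc_injective h.1
  | node t l, node t' l', h => by
    simp only [toBin, Bin.node.injEq] at h
    rw [Option.some.inj (enc_injective h.1), toBinAll_injective l l' h.2]
theorem toBinAll_injective : ∀ x y : List Syn, toBinAll x = toBinAll y → x = y
  | [], [], _ => rfl
  | [], _ :: _, h => by simp [toBinAll] at h
  | _ :: _, [], h => by simp [toBinAll] at h
  | x :: l, y :: l', h => by
    simp only [toBinAll, Bin.node.injEq] at h
    rw [toBin_injective x y h.1, toBinAll_injective l l' h.2]
end

noncomputable instance : TreeRep Syn := ⟨toBin, fun x y => toBin_injective x y⟩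

theorem toBinAll_eq (l : List Syn) : toBinAll l = enc l := by
  induction l with
  | nil => rfl
  | cons x l ih => rw [toBinAll, ih]; rfl

theorem enc_int (z : ℤ) : enc (int z) = .node (enc (none : Option Tok)) (enc z) := by
  show toBin _ = _
  rw [toBin]

theorem enc_node (t : Tok) (l : List Syn) : enc (node t l) = .node (enc (some t)) (enc l) := by
  show toBin _ = _
  rw [toBin, toBinAll_eq]

@[simp] theorem repSize_int' (z : ℤ) :
    repSize (int z) = repSize (none : Option Tok) + repSize z + 1 := by
  unfold repSize; rw [enc_int]; rfl

@[simp] theorem repSize_node (t : Tok) (l : List Syn) :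
    repSize (node t l) = repSize (some t) + repSize l + 1 := by
  unfold repSize; rw [enc_node]; rfl

end Syn

namespace PolyTime

variable {α β γ δ : Type} [TreeRep α] [TreeRep β] [TreeRep γ] [TreeRep δ]

/-- The part of the representation of a syntax tree after the tag. -/
noncomputable def payload : Syn → Bin
  | .int z => enc z
  | .node _ l => enc l

/-- Both kinds of syntax trees are represented by a tag paired with a payload, so the projections of
pairs apply; `args` and `val` then return the payload or a default, depending on the tag. -/
theorem enc_syn (x : Syn) : enc x = .node (enc x.tag) (payload x) := by
  cases x with
  | int z => exact Syn.enc_int z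
  | node t l => exact Syn.enc_node t l

theorem syn_tag' : PolyTime Syn.tag := by
  have h : Computes (fun x : Syn => .node (enc x.tag) (payload x)) fun x => enc x.tag :=
    Computes.left
  simp only [← enc_syn] at h
  exact h

theorem syn_payload : Computes (enc (α := Syn)) payload := by
  have h : Computes (fun x : Syn => .node (enc x.tag) (payload x)) payload := Computes.right
  simp only [← enc_syn] at h
  exact h

@[fun_prop] theorem syn_tag {f : α → Syn} (hf : PolyTime f) : PolyTime fun a => (f a).tag :=
  syn_tag'.comp hf

@[fun_prop] theorem syn_args {f : α → Syn} (hf : PolyTime f) : PolyTime fun a => (f a).args := by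
  refine comp (f := Syn.args) ?_ hf
  refine Computes.ite (c := fun x => decide (x.tag = none))
    (show PolyTime fun x : Syn => decide (x.tag = none) by fun_prop) ?_ ?_
  · have : ∀ i : {x : Syn // decide (x.tag = none) = true}, enc i.1.args = .leaf := by
      rintro ⟨_ | _, h⟩
      · rfl
      · simp [Syn.tag] at h
    simp only [this]
    exact Computes.const _ _
  · have : ∀ i : {x : Syn // decide (x.tag = none) = false}, enc i.1.args = payload i := by
      rintro ⟨_ | _, h⟩
      · simp [Syn.tag] at h
      · rfl
    simp only [this]
    exact Computes.reindex syn_payload Subtype.val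

@[fun_prop] theorem syn_val {f : α → Syn} (hf : PolyTime f) : PolyTime fun a => (f a).val := by
  refine comp (f := Syn.val) ?_ hf
  refine Computes.ite (c := fun x => decide (x.tag = none))
    (show PolyTime fun x : Syn => decide (x.tag = none) by fun_prop) ?_ ?_
  · have : ∀ i : {x : Syn // decide (x.tag = none) = true}, enc i.1.val = payload i := by
      rintro ⟨_ | _, h⟩
      · rfl
      · simp [Syn.tag] at h
    simp only [this]
    exact Computes.reindex syn_payload Subtype.val
  · have : ∀ i : {x : Syn // decide (x.tag = none) = false}, enc i.1.val = enc (0 : ℤ) := by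
      rintro ⟨_ | _, h⟩
      · simp [Syn.tag] at h
      · rfl
    simp only [this]
    exact Computes.const _ _

@[fun_prop] theorem syn_int {f : α → ℤ} (hf : PolyTime f) : PolyTime fun a => Syn.int (f a) := by
  unfold PolyTime
  simp only [Syn.enc_int]
  exact Computes.node (Computes.const _ _) hf

@[fun_prop] theorem syn_node {f : α → List Syn} (t : Tok) (hf : PolyTime f) :
    PolyTime fun a => Syn.node t (f a) := by
  unfold PolyTime
  simp only [Syn.enc_node]
  exact Computes.node (Computes.const _ _) hf

@[fun_prop] theorem take {f : α → List β} (hf : PolyTime f) (k : ℕ) :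
    PolyTime fun a => (f a).take k := by
  refine comp (f := fun l : List β => l.take k) ?_ hf
  induction k with
  | zero => simp only [List.take_zero]; fun_prop
  | succ k ih =>
    exact list_casesOn (f := fun l : List β => l) (g := fun _ => [])
      (h := fun x => x.2.1 :: x.2.2.take k) (by fun_prop) (by fun_prop)
      (cons (by fun_prop) (ih.comp (by fun_prop))) (fun a h => by simp [h])
      fun a x l h => by simp [h]

@[fun_prop] theorem drop {f : α → List β} (hf : PolyTime f) (k : ℕ) :
    PolyTime fun a => (f a).drop k := by
  induction k with
  | zero => simpa using hf
  | succ k ih => simpa only [List.tail_drop] using tail ih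

end PolyTime

-- The parser and its running time

/-- The number of arguments of a token in prefix notation. -/
def Tok.arity : Tok → ℕ
  | .var => 2
  | .arith _ => 2
  | .app => 4
  | .atom => 3
  | .eq => 2
  | .cmp _ => 2
  | .pos => 1
  | .not => 1
  | .notNot => 1
  | _ => 0

/-- States of the parser, which reads from right to left: the items of the list that is being read,
and those of the surrounding lists. -/
abbrev ParseState := List Syn × List (List Syn)

/-- Apply a tag to the topmost items. -/
def parseNode (t : Tok) (s : ParseState) : ParseState :=
  (.node t (s.1.take t.arity) :: s.1.drop t.arity, s.2)

/-- One step of the parser, which also evaluates arithmetic functions on numerals. -/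
def parseStep : Tok → ParseState → ParseState
  | .bit b, s => (.int (2 * (s.1.headD (.int 0)).val + b.toNat) :: s.1.tail, s.2)
  | .fin, s => (.int 0 :: s.1, s.2)
  | .minus, s => (.int (-(s.1.headD (.int 0)).val) :: s.1.tail, s.2)
  | .plus, s => s
  | .num, s => s
  | .cls, s => ([], s.1 :: s.2)
  | .opn, s => (.node .opn s.1 :: s.2.headD [], s.2.tail)
  | .arith op, s =>
    bif decide ((s.1.headD (.int 0)).tag = none) && decide ((s.1.tail.headD (.int 0)).tag = none)
    then (.int (op.eval (s.1.headD (.int 0)).val (s.1.tail.headD (.int 0)).val) :: s.1.tail.tail,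
      s.2)
    else parseNode (.arith op) s
  | t, s => parseNode t s

theorem polyTime_parseNode (t : Tok) : PolyTime (parseNode t) := by
  unfold parseNode
  fun_prop

theorem polyTime_arith (op : Arith) : PolyTime fun x : ℤ × ℤ => op.eval x.1 x.2 := by
  cases op <;> simp only [Arith.eval] <;> fun_prop

/-- There are finitely many tokens, so it is enough to treat each fixed token. -/
theorem polyTime_parseStep : PolyTime fun x : Tok × ParseState => parseStep x.1 x.2 := by
  refine PolyTime.of_finite fun t => ?_
  show PolyTime fun s => parseStep t s
  cases t
  case bit b => simp only [parseStep]; fun_prop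
  case fin => simp only [parseStep]; fun_prop
  case minus => simp only [parseStep]; fun_prop
  case plus => exact PolyTime.id
  case num => exact PolyTime.id
  case cls => simp only [parseStep]; fun_prop
  case opn => simp only [parseStep]; fun_prop
  case arith op =>
    have h := polyTime_parseNode (.arith op)
    have h' := polyTime_arith op
    have h'' := h'.comp (g := fun s : ParseState =>
      ((s.1.headD (.int 0)).val, (s.1.tail.headD (.int 0)).val)) (by fun_prop)
    simp only [parseStep]
    fun_prop
  all_goals exact polyTime_parseNode _

theorem exists_repSize_le (α : Type) [TreeRep α] [Finite α] : ∃ C, ∀ a : α, repSize a ≤ C := by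
  obtain ⟨C, hC⟩ := (Set.finite_range (repSize (α := α))).bddAbove
  exact ⟨C, fun a => hC ⟨a, rfl⟩⟩

theorem repSize_zero : repSize (0 : ℤ) = 1 := by rw [repSize_int, negaDigits_zero]; rfl

theorem Syn.repSize_val (x : Syn) : repSize x.val ≤ repSize x := by
  cases x with
  | int z => simp [Syn.val]; omega
  | node t l => simp only [Syn.val, repSize_zero]; exact repSize_pos _

theorem repSize_headD_add_tail {α : Type} [TreeRep α] (l : List α) (a : α) :
    repSize (l.headD a) + repSize l.tail ≤ repSize l + repSize a := by
  cases l <;> simp; omega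

theorem repSize_take_add_drop {α : Type} [TreeRep α] (l : List α) (k : ℕ) :
    repSize (l.take k) + repSize (l.drop k) = repSize l + 1 := by
  rw [← repSize_append, List.take_append_drop]

/-- The bound is additive even for products. As the operands leave the stack of the parser, nested
multiplications cannot make the state explode. -/
theorem repSize_arith_le (op : Arith) (x y : ℤ) :
    repSize (op.eval x y) ≤ repSize x + repSize y + 30 := by
  cases op
  · have := repSize_add_le x y; simp only [Arith.eval]; omega
  · have := repSize_add_le x (-y)
    have := repSize_neg_le y
    simp only [Arith.eval, sub_eq_add_neg]; omega
  · have := repSize_mul_le x y; simp only [Arith.eval]; omega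

/-- The increment `C` depends neither on the token nor on the state: all items taken from the top
are reused at most once, and tags have bounded size. This is the hypothesis on growth that
`PolyTime.foldl` needs. -/
theorem repSize_parseStep_le : ∃ C, ∀ t s, repSize (parseStep t s) ≤ repSize s + C := by
  obtain ⟨K, hK⟩ := exists_repSize_le (Option Tok)
  have hN : ∀ t s, repSize (parseNode t s) ≤ repSize s + K + 3 := by
    rintro t ⟨F, Fs⟩
    have := repSize_take_add_drop F t.arity
    have := hK (some t)
    simp only [parseNode, repSize_pair, repSize_cons, Syn.repSize_node]
    omega
  refine ⟨5 * K + 100, ?_⟩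
  rintro t ⟨F, Fs⟩
  have k0 := hK none
  have k1 := repSize_headD_add_tail F (.int 0)
  have k2 := repSize_headD_add_tail F.tail (.int 0)
  have k3 := Syn.repSize_val (F.headD (.int 0))
  have k4 := Syn.repSize_val (F.tail.headD (.int 0))
  have k5 := repSize_zero
  have k6 := repSize_pos F
  have k7 := hK (some .opn)
  have k8 := repSize_headD_add_tail Fs []
  have k9 := hN t (F, Fs)
  simp only [Syn.repSize_int', repSize_nil] at k1 k2 k8
  cases t
  case bit b =>
    have h1 := repSize_add_le (2 * (F.headD (.int 0)).val) b.toNat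
    have h2 := repSize_mul_le 2 (F.headD (.int 0)).val
    have h3 : repSize (2 : ℤ) ≤ 20 := by
      rw [repSize_int]
      have := length_negaDigits_le (z := 2) (n := 1) (by norm_num)
      omega
    have h4 : repSize (b.toNat : ℤ) ≤ 13 := by
      rw [repSize_int]
      have := length_negaDigits_le (z := b.toNat) (n := 0) (by cases b <;> simp)
      omega
    simp only [parseStep, repSize_pair, repSize_cons, Syn.repSize_int']
    omega
  case fin => simp only [parseStep, repSize_pair, repSize_cons, Syn.repSize_int']; omega
  case minus =>
    have h1 := repSize_neg_le (F.headD (.int 0)).val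
    simp only [parseStep, repSize_pair, repSize_cons, Syn.repSize_int']
    omega
  case plus => simp only [parseStep]; omega
  case num => simp only [parseStep]; omega
  case cls => simp only [parseStep, repSize_pair, repSize_cons, repSize_nil]; omega
  case opn =>
    simp only [parseStep, repSize_pair, repSize_cons, Syn.repSize_node]
    omega
  case arith op =>
    have h1 := repSize_arith_le op (F.headD (.int 0)).val (F.tail.headD (.int 0)).val
    simp only [parseStep]
    cases decide ((F.headD (.int 0)).tag = none) && decide ((F.tail.headD (.int 0)).tag = none)
    · simp only [cond_false]; omega
    · simp only [cond_true, repSize_pair, repSize_cons, Syn.repSize_int']; omega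
  all_goals
    simp only [parseStep]
    omega

/-- The result of parsing a string that is given in reverse order. -/
theorem polyTime_parse :
    PolyTime fun l : List Tok => l.foldl (fun s t => parseStep t s) (([], []) : ParseState) := by
  refine PolyTime.foldl (h := fun _ s t => parseStep t s) (by fun_prop) (by fun_prop) ?_ ?_
  · exact polyTime_parseStep.comp (g := fun x : List Tok × ParseState × Tok => (x.2.2, x.2.1))
      (by fun_prop)
  · obtain ⟨C, hC⟩ := repSize_parseStep_le
    exact ⟨(C : Polynomial ℕ), fun a s t => by simpa using hC t s⟩

end

section

open Turing Function

/-! ### Correctness of the parser -/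

/-- Reading the string `ts` amounts to putting `vs` on top. -/
def Parses (ts : List Tok) (vs : List Syn) : Prop :=
  ∀ F Fs, ts.foldr parseStep (F, Fs) = (vs ++ F, Fs)

theorem Parses.append {ts ts' : List Tok} {vs vs' : List Syn} (h : Parses ts vs)
    (h' : Parses ts' vs') : Parses (ts ++ ts') (vs ++ vs') := by
  intro F Fs
  rw [List.foldr_append, h' F Fs, h, List.append_assoc]

/-- Reading from right to left, the closing bracket comes first: it saves the current items and
starts an empty list, which the opening bracket wraps up and puts on top of the saved items. -/
theorem Parses.encList {α : Type} {f : α → List Tok} {g : α → List Syn} {l : List α}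
    (h : ∀ a ∈ l, Parses (f a) (g a)) : Parses (encList f l) [.node .opn (l.flatMap g)] := by
  have key : Parses (l.flatMap f) (l.flatMap g) := by
    induction l with
    | nil => intro F Fs; rfl
    | cons a l ih =>
      exact (h a List.mem_cons_self).append (ih fun b hb => h b (List.mem_cons_of_mem _ hb))
  intro F Fs
  have h1 := key [] (F :: Fs)
  simp only [ModASP.encList, List.foldr_cons, List.foldr_append, List.foldr_nil]
  rw [show parseStep .cls (F, Fs) = ([], F :: Fs) from rfl, h1]
  simp [parseStep]

theorem Parses.of_parseNode {ts : List Tok} {vs : List Syn} {t : Tok} (h : Parses ts vs)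
    (ht : ∀ s, parseStep t s = parseNode t s) (ha : t.arity = vs.length) :
    Parses (t :: ts) [.node t vs] := by
  intro F Fs
  rw [List.foldr_cons, h F Fs, ht]
  simp [parseNode, ha]

theorem Parses.congr {ts : List Tok} {vs vs' : List Syn} (h : Parses ts vs) (e : vs = vs') :
    Parses ts vs' := e ▸ h

/-- Binary numbers are written with the least significant bit first, so reading them from the right
is Horner's rule. -/
theorem foldr_encodePosNum (n : PosNum) :
    (Computability.encodePosNum n).foldr (fun b z => 2 * z + (b.toNat : ℤ)) 0 = ((n : ℕ) : ℤ) := by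
  induction n with
  | one => simp [Computability.encodePosNum]
  | bit0 n ih =>
    simp only [Computability.encodePosNum, List.foldr_cons, ih, PosNum.cast_bit0]
    simp; ring
  | bit1 n ih =>
    simp only [Computability.encodePosNum, List.foldr_cons, ih, PosNum.cast_bit1]
    simp; ring

theorem foldr_encodeNat (n : ℕ) :
    (Computability.encodeNat n).foldr (fun b z => 2 * z + (b.toNat : ℤ)) 0 = (n : ℤ) := by
  unfold Computability.encodeNat
  conv_rhs => rw [← Num.to_of_nat n]
  cases (n : Num) with
  | zero => rfl
  | pos p => exact foldr_encodePosNum p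

theorem parses_encNat (n : ℕ) : Parses (encNat n) [.int n] := by
  have key : ∀ (l : List Bool) F Fs, (l.map Tok.bit).foldr parseStep (.int 0 :: F, Fs) =
      (.int (l.foldr (fun b z => 2 * z + (b.toNat : ℤ)) 0) :: F, Fs) := by
    intro l F Fs
    induction l with
    | nil => rfl
    | cons b l ih => rw [List.map_cons, List.foldr_cons, ih]; rfl
  intro F Fs
  rw [encNat, List.foldr_append]
  exact (key _ F Fs).trans (by rw [foldr_encodeNat]; rfl)

theorem parses_encInt (z : ℤ) : Parses (encInt z) [.int z] := by
  intro F Fs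
  rw [encInt, List.foldr_cons, parses_encNat]
  split_ifs with h
  · simp [parseStep, Syn.val, abs_of_neg h]
  · simp [parseStep]; omega

def Srt.syn (s : Srt) : Syn := .node (.sort s) []

theorem parses_sort (s : Srt) : Parses [.sort s] [s.syn] := fun _ _ => rfl

/-- The syntax tree of a list of sorts. -/
def sortsSyn (l : List Srt) : Syn := .node .opn (l.map Srt.syn)

theorem parses_sorts (l : List Srt) : Parses (encList (fun s => [Tok.sort s]) l) [sortsSyn l] :=
  (Parses.encList (g := fun s => [s.syn]) fun s _ => parses_sort s).congr (by
    rw [← List.map_eq_flatMap]; rfl)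

mutual
/-- The syntax tree of a term. -/
def Term.syn : Term → Syn
  | .var v => .node .var [v.sort.syn, .int v.idx]
  | .num z => .int z
  | .arith op a b => .node (.arith op) [a.syn, b.syn]
  | .app f ts => .node .app [.int f.idx, sortsSyn f.args, f.res.syn, .node .opn (Term.synAll ts)]
def Term.synAll : List Term → List Syn
  | [] => []
  | t :: ts => t.syn :: Term.synAll ts
end

theorem Term.normList_eq (ts : List Term) : Term.normList ts = ts.map Term.norm := by
  induction ts with
  | nil => rfl
  | cons t ts ih => rw [Term.normList, ih]; rfl

theorem parses_funSym (f : FunSym) : Parses f.enc [.int f.idx, sortsSyn f.args, f.res.syn] :=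
  ((parses_encNat _).append (parses_sorts _)).append (parses_sort _)

theorem Term.syn_tag_eq_none (t : Term) : t.syn.tag = none ↔ ∃ z, t = .num z := by
  cases t <;> simp [Term.syn, Syn.tag]

mutual
-- The operands are on top of the stack, already evaluated, when the arithmetic token is read. Only
-- numerals have trees without a tag, so the test in `parseStep` makes the same case distinction as
-- `Term.norm`.
theorem Term.parses : ∀ t : Term, Parses t.enc [t.norm.syn]
  | .var v => by
    have h := Parses.of_parseNode (t := .var) ((parses_sort v.sort).append (parses_encNat v.idx))
      (fun _ => rfl) rfl
    simpa [Term.enc, Term.norm, Term.syn] using h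
  | .num z => by
    intro F Fs
    rw [Term.enc, List.foldr_cons, parses_encInt, Term.norm, Term.syn]
    rfl
  | .arith op a b => by
    intro F Fs
    rw [Term.enc, List.foldr_cons, (Term.parses a).append (Term.parses b)]
    by_cases ha : ∃ z, a.norm = .num z
    · by_cases hb : ∃ z, b.norm = .num z
      · obtain ⟨m, ha⟩ := ha
        obtain ⟨n, hb⟩ := hb
        simp [Term.norm, ha, hb, Term.syn, parseStep, Syn.tag, Syn.val]
      · have h2 := mt (Term.syn_tag_eq_none _).1 hb
        have e : (Term.arith op a b).norm = .arith op a.norm b.norm := by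
          rw [Term.norm]
          split
          · exact absurd ⟨_, ‹b.norm = _›⟩ hb
          · rfl
        simp [e, Term.syn, parseStep, h2, parseNode, Tok.arity]
    · have h1 := mt (Term.syn_tag_eq_none _).1 ha
      have e : (Term.arith op a b).norm = .arith op a.norm b.norm := by
        rw [Term.norm]
        split
        · exact absurd ⟨_, ‹a.norm = _›⟩ ha
        · rfl
      simp [e, Term.syn, parseStep, h1, parseNode, Tok.arity]
  | .app f ts => by
    have h1 : Parses (Tok.opn :: (Term.encAll ts ++ [Tok.cls]))
        [.node .opn (Term.synAll (Term.normList ts))] := by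
      intro F Fs
      have := Term.parsesAll ts [] (F :: Fs)
      simp only [List.foldr_cons, List.foldr_append, List.foldr_nil]
      rw [show parseStep .cls (F, Fs) = ([], F :: Fs) from rfl, this]
      simp [parseStep]
    have h := Parses.of_parseNode (t := .app) ((parses_funSym f).append h1) (fun _ => rfl) rfl
    simpa [Term.enc, Term.norm, Term.syn] using h
theorem Term.parsesAll : ∀ ts : List Term,
    Parses (Term.encAll ts) (Term.synAll (Term.normList ts))
  | [] => fun _ _ => rfl
  | t :: ts => by
    have h := (Term.parses t).append (Term.parsesAll ts)
    simpa [Term.encAll, Term.synAll, Term.normList] using h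
end

theorem Srt.syn_injective : Injective Srt.syn := by
  intro a b h
  simpa [Srt.syn] using h

theorem sortsSyn_injective : Injective sortsSyn := by
  intro a b h
  simp only [sortsSyn, Syn.node.injEq, true_and] at h
  exact Srt.syn_injective.list_map h

mutual
theorem Term.syn_injective : ∀ a b : Term, a.syn = b.syn → a = b
  | .var v, b, h => by
    cases b with
    | var w =>
      simp only [Term.syn, Syn.node.injEq, List.cons.injEq, Syn.int.injEq, Nat.cast_inj,
        Srt.syn_injective.eq_iff] at h
      obtain ⟨s, i⟩ := v
      obtain ⟨s', i'⟩ := w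
      simp_all
    | _ => simp [Term.syn] at h
  | .num z, b, h => by cases b <;> simp_all [Term.syn]
  | .arith op x y, b, h => by
    cases b with
    | arith op' x' y' =>
      simp only [Term.syn, Syn.node.injEq, List.cons.injEq, Tok.arith.injEq] at h
      rw [h.1, Term.syn_injective x x' h.2.1, Term.syn_injective y y' h.2.2.1]
    | _ => simp [Term.syn] at h
  | .app f ts, b, h => by
    cases b with
    | app f' ts' =>
      simp only [Term.syn, Syn.node.injEq, List.cons.injEq, Syn.int.injEq, Nat.cast_inj,
        Srt.syn_injective.eq_iff, sortsSyn_injective.eq_iff] at h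
      rw [Term.synAll_injective ts ts' (by simpa using h.2.2.2.2.1)]
      obtain ⟨i, a, r⟩ := f
      obtain ⟨i', a', r'⟩ := f'
      simp_all
    | _ => simp [Term.syn] at h
theorem Term.synAll_injective : ∀ a b : List Term, Term.synAll a = Term.synAll b → a = b
  | [], b, h => by cases b <;> simp_all [Term.synAll]
  | t :: ts, b, h => by
    cases b with
    | nil => simp [Term.synAll] at h
    | cons t' ts' =>
      simp only [Term.synAll, List.cons.injEq] at h
      rw [Term.syn_injective t t' h.1, Term.synAll_injective ts ts' h.2]
end

/-- Arguments appear in evaluated form, so that tests on the tree see `[t]` instead of `t`. -/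
def Atom.syn (A : Atom) : Syn :=
  .node .atom [.int A.pred.idx, sortsSyn A.pred.args, .node .opn (A.args.map fun t => t.norm.syn)]

theorem Atom.parses (A : Atom) : Parses A.enc [A.syn] := by
  have h1 : Parses (encList Term.enc A.args) [.node .opn (A.args.map fun t => t.norm.syn)] :=
    (Parses.encList (g := fun t : Term => [t.norm.syn]) fun t _ => t.parses).congr (by
      rw [← List.map_eq_flatMap])
  exact Parses.of_parseNode (t := .atom)
    (((parses_encNat A.pred.idx).append (parses_sorts A.pred.args)).append h1) (fun _ => rfl) rfl

def AtomicFormula.syn : AtomicFormula → Syn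
  | .atom A => A.syn
  | .eq a b => .node .eq [a.norm.syn, b.norm.syn]
  | .cmp c a b => .node (.cmp c) [a.norm.syn, b.norm.syn]

theorem AtomicFormula.parses (F : AtomicFormula) : Parses F.enc [F.syn] := by
  cases F with
  | atom A => exact A.parses
  | eq a b => exact Parses.of_parseNode (a.parses.append b.parses) (fun _ => rfl) rfl
  | cmp c a b => exact Parses.of_parseNode (a.parses.append b.parses) (fun _ => rfl) rfl

def Literal.syn : Literal → Syn
  | .pos F => .node .pos [F.syn]
  | .not F => .node .not [F.syn]
  | .notNot F => .node .notNot [F.syn]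

theorem Literal.parses (L : Literal) : Parses L.enc [L.syn] := by
  cases L <;> exact Parses.of_parseNode (AtomicFormula.parses _) (fun _ => rfl) rfl

def headSyn : Option AtomicFormula → Syn
  | none => .node .bot []
  | some F => F.syn

/-- A rule is written as two consecutive items without brackets around them; the parser leaves a
flat list, which `pairUp` splits again. -/
def Rule.synPair (r : Rule) : Syn × Syn :=
  (headSyn r.head, .node .opn (r.body.map Literal.syn))

theorem Rule.parses (r : Rule) : Parses r.enc [r.synPair.1, r.synPair.2] := by
  have h1 : Parses (encList Literal.enc r.body) [r.synPair.2] :=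
    (Parses.encList (g := fun L : Literal => [L.syn]) fun L _ => L.parses).congr (by
      rw [← List.map_eq_flatMap]; rfl)
  have h2 : Parses (match r.head with | none => [Tok.bot] | some F => F.enc) [r.synPair.1] := by
    unfold Rule.synPair
    cases r.head with
    | none => exact fun _ _ => rfl
    | some F => exact F.parses
  exact h2.append h1

/-- Write pairs one after another. -/
def unpair (l : List (Syn × Syn)) : List Syn := l.flatMap fun x => [x.1, x.2]

def LPModule.synPair (Δ : LPModule) : Syn × Syn :=
  (.node .opn (Δ.int.map Atom.syn), .node .opn (unpair (Δ.rules.map Rule.synPair)))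

theorem Intensionality.parses (κ : Intensionality) :
    Parses κ.enc [.node .opn (List.map Atom.syn κ)] :=
  (Parses.encList (g := fun A : Atom => [A.syn]) fun A _ => A.parses).congr (by
    rw [← List.map_eq_flatMap])

theorem LPModule.parses (Δ : LPModule) : Parses Δ.enc [Δ.synPair.1, Δ.synPair.2] :=
  (Intensionality.parses _).append ((Parses.encList
    (g := fun r : Rule => [r.synPair.1, r.synPair.2]) fun r _ => r.parses).congr (by
      simp [LPModule.synPair, unpair, List.flatMap_map]))

theorem ModularProgram.parses (P : ModularProgram) :
    Parses P.enc [.node .opn (List.map Atom.syn P.int),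
      .node .opn (unpair (P.modules.map LPModule.synPair))] :=
  (Intensionality.parses _).append ((Parses.encList
    (g := fun Δ : LPModule => [Δ.synPair.1, Δ.synPair.2]) fun Δ _ => Δ.parses).congr (by
      simp [unpair, List.flatMap_map]))

end

section

open Turing Function

open TreeRep

/-! ### List operations -/

/-- Unary notation is affordable because these numbers only serve as positions of modules in a list.
-/
instance : TreeRep ℕ where
  enc n := enc (List.replicate n true)
  enc_injective m n h := by simpa using congrArg List.length (enc_injective h)

theorem repSize_succ (n : ℕ) : repSize (n + 1) = repSize n + 6 := by
  show repSize (List.replicate (n + 1) true) = repSize (List.replicate n true) + 6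
  rw [List.replicate_succ, repSize_cons, repSize_bool]
  omega

/-- The edges of walks of length at most `n` from a vertex. -/
def walkEdges {α : Type} [DecidableEq α] (E : List (α × α)) (a : α) : ℕ → List (α × α)
  | 0 => []
  | n + 1 => E.filter fun e => decide (e.1 = a) || (walkEdges E a n).any fun f => decide (f.2 = e.1)

/-- Reachability of `b` from `a` in the graph with the edges `E`. -/
def reach {α : Type} [DecidableEq α] (E : List (α × α)) (a b : α) : Bool :=
  decide (a = b) || (walkEdges E a E.length).any fun f => decide (f.2 = b)

/-- The recursion as a fold over a list whose elements are ignored: the list is a clock. -/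
theorem foldl_walkEdges {α : Type} [DecidableEq α] (E l : List (α × α)) (a : α) (n : ℕ) :
    l.foldl (fun F _ => E.filter fun e => decide (e.1 = a) || F.any fun f => decide (f.2 = e.1))
      (walkEdges E a n) = walkEdges E a (n + l.length) := by
  induction l generalizing n with
  | nil => rfl
  | cons x l ih =>
    rw [List.foldl_cons, List.length_cons, Nat.add_comm l.length, ← Nat.add_assoc, ← ih]
    rfl

theorem walkEdges_sublist {α : Type} [DecidableEq α] (E : List (α × α)) (a : α) (n : ℕ) :
    (walkEdges E a n).Sublist E := by
  cases n with
  | zero => exact List.nil_sublist _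
  | succ n => exact List.filter_sublist

/-- Split a list into pairs. -/
def pairUp (l : List Syn) : List (Syn × Syn) :=
  (l.foldl (fun (s : List Syn × List (Syn × Syn)) x =>
    bif s.1.isEmpty then ([x], s.2) else ([], (s.1.headD (.int 0), x) :: s.2)) ([], [])).2.reverse

theorem pairUp_unpair (l : List (Syn × Syn)) : pairUp (unpair l) = l := by
  have key : ∀ (l : List (Syn × Syn)) (o : List (Syn × Syn)),
      (unpair l).foldl (fun (s : List Syn × List (Syn × Syn)) x =>
        bif s.1.isEmpty then ([x], s.2) else ([], (s.1.headD (.int 0), x) :: s.2)) ([], o) =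
      ([], l.reverse ++ o) := by
    intro l
    induction l with
    | nil => intro o; rfl
    | cons x l ih =>
      intro o
      have := ih (x :: o)
      simp only [unpair, List.flatMap_cons, List.foldl_append] at this ⊢
      simpa using this
  rw [pairUp, key]
  simp

-- Polynomial-time reachability, pairing and indexing of lists

namespace PolyTime

variable {α β γ δ : Type} [TreeRep α] [TreeRep β] [TreeRep γ] [TreeRep δ]

@[fun_prop] theorem reach [DecidableEq β] {f : α → List (β × β)} {g h : α → β} (hf : PolyTime f)
    (hg : PolyTime g) (hh : PolyTime h) : PolyTime fun a => reach (f a) (g a) (h a) := by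
  -- The edge list is its own clock. All accumulators are sublists of it, so their sizes stay
  -- bounded.
  have : PolyTime fun a => (f a).foldl (fun F _ => (f a).filter fun e =>
      decide (e.1 = g a) || F.any fun f => decide (f.2 = e.1)) [] := by
    refine foldl_of_bound hf (by fun_prop) (by fun_prop) ?_
    obtain ⟨q, hq⟩ := hf.repSize_le
    refine ⟨q, fun a l _ => ?_⟩
    have := foldl_walkEdges (f a) l (g a) 0
    rw [walkEdges] at this
    rw [this]
    exact (repSize_sublist (walkEdges_sublist _ _ _)).trans (hq a)
  have e : ∀ a, (f a).foldl (fun F _ => (f a).filter fun e =>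
      decide (e.1 = g a) || F.any fun f => decide (f.2 = e.1)) [] =
      walkEdges (f a) (g a) (f a).length := fun a => by
    have := foldl_walkEdges (f a) (f a) (g a) 0
    rw [Nat.zero_add] at this
    exact this
  simp only [e] at this
  unfold ModASP.reach
  fun_prop

@[fun_prop] theorem pairUp {f : α → List Syn} (hf : PolyTime f) :
    PolyTime fun a => pairUp (f a) := by
  have : PolyTime fun a => (f a).foldl (fun (s : List Syn × List (Syn × Syn)) x =>
      bif s.1.isEmpty then ([x], s.2) else ([], (s.1.headD (.int 0), x) :: s.2)) ([], []) := by
    refine foldl (h := fun _ (s : List Syn × List (Syn × Syn)) x =>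
      bif s.1.isEmpty then ([x], s.2) else ([], (s.1.headD (.int 0), x) :: s.2))
      hf (by fun_prop) (by fun_prop) ⟨.X + 5, fun a ⟨s, o⟩ b => ?_⟩
    cases s <;> simp <;> omega
  unfold ModASP.pairUp
  fun_prop

@[fun_prop] theorem succ {f : α → ℕ} (hf : PolyTime f) : PolyTime fun a => f a + 1 := by
  have : PolyTime fun a => true :: List.replicate (f a) true :=
    cons (const _) (show PolyTime f from hf)
  exact this

@[fun_prop] theorem zipIdx {f : α → List β} (hf : PolyTime f) :
    PolyTime fun a => (f a).zipIdx := by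
  have : PolyTime fun a => ((f a).foldl (fun (s : ℕ × List (β × ℕ)) x =>
      (s.1 + 1, (x, s.1) :: s.2)) (0, [])).2.reverse := by
    have : PolyTime fun a => (f a).foldl (fun (s : ℕ × List (β × ℕ)) x =>
        (s.1 + 1, (x, s.1) :: s.2)) (0, []) := by
      -- The increment depends on the index in the accumulator, so the additive criterion does not
      -- apply; with unary indices the total size is at most quadratic.
      refine foldl_of_bound (h := fun _ (s : ℕ × List (β × ℕ)) x =>
        (s.1 + 1, (x, s.1) :: s.2)) hf (by fun_prop) (by fun_prop) ?_
      obtain ⟨q, hq⟩ := hf.repSize_le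
      refine ⟨100 * (q + 1) * (q + 1), fun a l hl => ?_⟩
      have key : ∀ (l : List β) (n : ℕ) (o : List (β × ℕ)),
          repSize (l.foldl (fun (s : ℕ × List (β × ℕ)) x =>
            (s.1 + 1, (x, s.1) :: s.2)) (n, o)) ≤
          repSize o + repSize l + repSize n + l.length * (repSize n + 6 * l.length + 20) := by
        intro l
        induction l with
        | nil => intro n o; simp; omega
        | cons x l ih =>
          intro n o
          have := ih (n + 1) ((x, n) :: o)
          simp only [repSize_succ, repSize_cons, repSize_pair] at this
          simp only [List.foldl_cons, List.length_cons, repSize_cons]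
          nlinarith
      have h1 := key l 0 []
      have h2 := length_le_repSize l
      have h3 := (repSize_sublist hl.sublist).trans (hq a)
      have h4 : repSize (0 : ℕ) = 1 := rfl
      simp only [repSize_nil, h4] at h1
      simp only [Polynomial.eval_mul, Polynomial.eval_add, Polynomial.eval_one,
        Polynomial.eval_ofNat]
      refine h1.trans ?_
      have h5 := h2.trans h3
      generalize q.eval (repSize a) = Q at *
      have : l.length * (1 + 6 * l.length + 20) ≤ Q * (1 + 6 * Q + 20) :=
        Nat.mul_le_mul h5 (by omega)
      nlinarith
    fun_prop
  convert this using 2 with a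
  have key : ∀ (l : List β) (n : ℕ) (o : List (β × ℕ)),
      (l.foldl (fun (s : ℕ × List (β × ℕ)) x => (s.1 + 1, (x, s.1) :: s.2)) (n, o)).2 =
      (l.zipIdx n).reverse ++ o := by
    intro l
    induction l with
    | nil => intro n o; rfl
    | cons x l ih => intro n o; simp [ih]
  rw [key]
  simp

@[fun_prop] theorem zip {f : α → List β} {g : α → List γ} (hf : PolyTime f) (hg : PolyTime g) :
    PolyTime fun a => (f a).zip (g a) := by
  let st : List γ × List (β × γ) → β → List γ × List (β × γ) := fun s x =>
    match s.1 with
    | [] => s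
    | y :: l => (l, (x, y) :: s.2)
  have hst : PolyTime fun x : α × (List γ × List (β × γ)) × β => st x.2.1 x.2.2 := by
    refine list_casesOn (f := fun x : α × (List γ × List (β × γ)) × β => x.2.1.1)
      (g := fun x => x.2.1) (h := fun x => (x.2.2, (x.1.2.2, x.2.1) :: x.1.2.1.2))
      (by fun_prop) (by fun_prop) (by fun_prop) (fun a h => by simp [st, h])
      fun a x l h => by simp [st, h]
  have : PolyTime fun a => (f a).foldl st (g a, []) := by
    refine foldl (h := fun _ => st) hf (by fun_prop) hst ⟨.X + 5, fun a ⟨s, o⟩ b => ?_⟩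
    cases s <;> simp [st]; omega
  have h2 : PolyTime fun a => ((f a).foldl st (g a, [])).2.reverse := by fun_prop
  convert h2 using 2 with a
  have key : ∀ (l : List β) (l' : List γ) (o : List (β × γ)),
      (l.foldl st (l', o)).2 = (l.zip l').reverse ++ o := by
    intro l
    induction l with
    | nil => intro n o; rfl
    | cons x l ih =>
      intro l' o
      cases l' with
      | nil => have := ih [] o; simpa [st] using this
      | cons y l' => simp [st, ih]
  rw [key]
  simp

end PolyTime

/-! ### The decision procedure -/

namespace Syn

/-- The argument of index `k`. -/
def arg (k : ℕ) (x : Syn) : Syn := (x.args.drop k).headD (.int 0)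

def isVar (x : Syn) : Bool := decide (x.tag = some .var)

def isAtom (x : Syn) : Bool := decide (x.tag = some .atom)

/-- The sort of a term is the integer sort. -/
noncomputable def isInt (x : Syn) : Bool :=
  decide (x.tag = none) || (isVar x && decide (x.arg 0 = Srt.int.syn)) ||
    decide (x.tag = some (.arith .add)) || decide (x.tag = some (.arith .sub)) ||
    decide (x.tag = some (.arith .mul)) ||
    (decide (x.tag = some .app) && decide (x.arg 2 = Srt.int.syn))

/-- The predicate symbol of an atom. -/
def key (x : Syn) : Syn × Syn := (x.arg 0, x.arg 1)

/-- The arguments of an atom. -/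
def tuple (x : Syn) : List Syn := (x.arg 2).args

/-- The term `t` is an instance of `u`. -/
noncomputable def matchTerm (u t : Syn) : Bool :=
  bif isVar u then decide (u.arg 0 = Srt.gen.syn) || isInt t else decide (u = t)

/-- Positions are tested independently: in a simple tuple no variable occurs twice, so there is
nothing to reconcile between them. -/
noncomputable def matchTuple (us ts : List Syn) : Bool := (us.zip ts).all fun x => matchTerm x.1 x.2

/-- The arguments of an atom match an intensionality statement. -/
noncomputable def matchAtom (κ : List Syn) (A : Syn) : Bool :=
  κ.any fun B => decide (key B = key A) && matchTuple (tuple B) (tuple A)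

/-- Two tuples of variables and precomputed terms unify: in the graph with edges between
corresponding elements, every precomputed term is an instance of all elements that are connected
with it. -/
noncomputable def unifyTuple (us ws : List Syn) : Bool :=
  !((us ++ ws).any fun g => (us ++ ws).any fun x =>
    !isVar g && reach (us.zip ws ++ ws.zip us) g x && !matchTerm x g)

/-- The nonnegated atoms in the body of a rule. -/
def posAtoms (r : Syn × Syn) : List Syn :=
  (r.2.args.filter fun L => decide (L.tag = some .pos) && isAtom (L.arg 0)).map (arg 0)

end Syn

open Syn

/-- Modules as an intensionality statement and a list of rules. -/
abbrev SynModule := List Syn × List (Syn × Syn)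

noncomputable def simpleTest (M : List SynModule) : Bool :=
  M.all fun Δ => Δ.2.all fun r => !isAtom r.1 || matchAtom Δ.1 r.1

/-- The edges of the dependency graph. -/
noncomputable def edgeList (M : List SynModule) : List (((Syn × Syn) × ℕ) × ((Syn × Syn) × ℕ)) :=
  M.flatMap fun Δ => Δ.2.flatMap fun r => (posAtoms r).flatMap fun B =>
    M.zipIdx.flatMap fun i => M.zipIdx.flatMap fun j =>
      bif isAtom r.1 && matchAtom i.1.1 r.1 && matchAtom j.1.1 B
      then [((key r.1, i.2), (key B, j.2))] else []

/-- No edge between different modules lies on a closed walk. -/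
noncomputable def componentTest (M : List SynModule) : Bool :=
  (edgeList M).all fun e => decide (e.1.2 = e.2.2) || !reach (edgeList M) e.2 e.1

noncomputable def disjointTest (M : List SynModule) : Bool :=
  M.zipIdx.all fun i => M.zipIdx.all fun j => decide (i.2 = j.2) ||
    i.1.1.all fun u => j.1.1.all fun w =>
      !decide (key u = key w) || !unifyTuple (tuple u) (tuple w)

noncomputable def coherentTest (M : List SynModule) : Bool :=
  simpleTest M && componentTest M && disjointTest M

/-- Extract the modules from the result of parsing. -/
def synModules (s : ParseState) : List SynModule :=
  (pairUp (s.1.tail.headD (.int 0)).args).map fun x => (x.1.args, pairUp x.2.args)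

-- Running time of the decision procedure

section
variable {α β γ δ : Type} [TreeRep α] [TreeRep β] [TreeRep γ] [TreeRep δ]

@[fun_prop] theorem PolyTime.syn_arg (k : ℕ) {f : α → Syn} (hf : PolyTime f) :
    PolyTime fun a => (f a).arg k := by
  unfold Syn.arg; fun_prop

@[fun_prop] theorem PolyTime.syn_isVar {f : α → Syn} (hf : PolyTime f) :
    PolyTime fun a => (f a).isVar := by
  unfold Syn.isVar; fun_prop

@[fun_prop] theorem PolyTime.syn_isAtom {f : α → Syn} (hf : PolyTime f) :
    PolyTime fun a => (f a).isAtom := by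
  unfold Syn.isAtom; fun_prop

@[fun_prop] theorem PolyTime.syn_isInt {f : α → Syn} (hf : PolyTime f) :
    PolyTime fun a => (f a).isInt := by
  unfold Syn.isInt; fun_prop

@[fun_prop] theorem PolyTime.syn_key {f : α → Syn} (hf : PolyTime f) :
    PolyTime fun a => (f a).key := by
  unfold Syn.key; fun_prop

@[fun_prop] theorem PolyTime.syn_tuple {f : α → Syn} (hf : PolyTime f) :
    PolyTime fun a => (f a).tuple := by
  unfold Syn.tuple; fun_prop

@[fun_prop] theorem PolyTime.syn_matchTerm {f g : α → Syn} (hf : PolyTime f) (hg : PolyTime g) :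
    PolyTime fun a => matchTerm (f a) (g a) := by
  unfold Syn.matchTerm; fun_prop

@[fun_prop] theorem PolyTime.syn_matchTuple {f g : α → List Syn} (hf : PolyTime f)
    (hg : PolyTime g) : PolyTime fun a => matchTuple (f a) (g a) := by
  unfold Syn.matchTuple; fun_prop

@[fun_prop] theorem PolyTime.syn_matchAtom {f : α → List Syn} {g : α → Syn} (hf : PolyTime f)
    (hg : PolyTime g) : PolyTime fun a => matchAtom (f a) (g a) := by
  unfold Syn.matchAtom; fun_prop

@[fun_prop] theorem PolyTime.syn_unifyTuple {f g : α → List Syn} (hf : PolyTime f)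
    (hg : PolyTime g) : PolyTime fun a => unifyTuple (f a) (g a) := by
  unfold Syn.unifyTuple; fun_prop

@[fun_prop] theorem PolyTime.syn_posAtoms {f : α → Syn × Syn} (hf : PolyTime f) :
    PolyTime fun a => posAtoms (f a) := by
  unfold Syn.posAtoms; fun_prop

@[fun_prop] theorem polyTime_simpleTest : PolyTime simpleTest := by
  unfold simpleTest; fun_prop

@[fun_prop] theorem polyTime_edgeList : PolyTime edgeList := by
  unfold edgeList; fun_prop

@[fun_prop] theorem polyTime_componentTest : PolyTime componentTest := by
  unfold componentTest; fun_prop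

@[fun_prop] theorem polyTime_disjointTest : PolyTime disjointTest := by
  unfold disjointTest; fun_prop

@[fun_prop] theorem polyTime_coherentTest : PolyTime coherentTest := by
  unfold coherentTest; fun_prop

theorem polyTime_synModules : PolyTime synModules := by
  unfold synModules; fun_prop

end

end

section

open Turing Function Relation

open Syn

/-! ### Reachability -/

section
variable {α : Type} [DecidableEq α] {E : List (α × α)} {a b : α}

theorem mem_walkEdges_succ {n : ℕ} {e : α × α} :
    e ∈ walkEdges E a (n + 1) ↔ e ∈ E ∧ (e.1 = a ∨ ∃ f ∈ walkEdges E a n, f.2 = e.1) := by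
  simp [walkEdges]

theorem walkEdges_sublist_succ (n : ℕ) : (walkEdges E a n).Sublist (walkEdges E a (n + 1)) := by
  induction n with
  | zero => exact List.nil_sublist _
  | succ n ih =>
    refine List.monotone_filter_right E fun e he => ?_
    simp only [Bool.or_eq_true, List.any_eq_true] at he ⊢
    exact he.imp_right fun ⟨f, hf, h⟩ => ⟨f, ih.subset hf, h⟩

theorem walkEdges_eq_of_eq {n m : ℕ} (h : walkEdges E a (n + 1) = walkEdges E a n) (hm : n ≤ m) :
    walkEdges E a m = walkEdges E a n := by
  induction m, hm using Nat.le_induction with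
  | base => rfl
  | succ m _ ih => rw [walkEdges, ih]; exact h

/-- The sets of edges increase with `n` and are constant from the first repetition on. Without a
repetition up to `E.length`, there would be more than `E.length` edges in a sublist of `E`. -/
theorem walkEdges_stable (E : List (α × α)) (a : α) :
    walkEdges E a (E.length + 1) = walkEdges E a E.length := by
  by_cases h : ∃ n ≤ E.length, walkEdges E a (n + 1) = walkEdges E a n
  · obtain ⟨n, hn, h⟩ := h
    rw [walkEdges_eq_of_eq h hn, walkEdges_eq_of_eq h (by omega)]
  · push Not at h
    have key : ∀ n ≤ E.length + 1, n ≤ (walkEdges E a n).length := by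
      intro n
      induction n with
      | zero => simp
      | succ n ih =>
        intro hn
        have h1 := ih (by omega)
        by_contra! hlt
        exact h n (by omega) ((walkEdges_sublist_succ n).eq_of_length_le (by omega)).symm
    have h1 := key (E.length + 1) le_rfl
    have h2 := (walkEdges_sublist E a (E.length + 1)).length_le
    omega

theorem reach_iff : reach E a b = true ↔ ReflTransGen (fun x y => (x, y) ∈ E) a b := by
  simp only [reach, Bool.or_eq_true, decide_eq_true_eq, List.any_eq_true]
  constructor
  · have key : ∀ n, ∀ f ∈ walkEdges E a n, ReflTransGen (fun x y => (x, y) ∈ E) a f.2 := by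
      intro n
      induction n with
      | zero => simp [walkEdges]
      | succ n ih =>
        intro f hf
        obtain ⟨hE, h⟩ := mem_walkEdges_succ.1 hf
        rcases h with h | ⟨g, hg, h⟩
        · exact .single (h ▸ hE)
        · exact (ih g hg).tail (h ▸ hE)
    rintro (rfl | ⟨f, hf, rfl⟩)
    · exact .refl
    · exact key _ f hf
  · intro h
    induction h with
    | refl => exact .inl rfl
    | @tail x y _ hxy ih =>
      refine .inr ⟨(x, y), ?_, rfl⟩
      -- Extending a walk takes one more round, which stability makes free.
      rw [← walkEdges_stable, mem_walkEdges_succ]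
      exact ⟨hxy, ih.imp_left Eq.symm⟩

end

/-- All successors of an image point are images, so a walk that starts in the image of `φ` never
leaves it. This transfers reachability from representations to the objects represented. -/
theorem reflTransGen_map_iff {α β : Type} {R : α → α → Prop} {R' : β → β → Prop} {φ : α → β}
    (hφ : Injective φ) (h : ∀ x b, R' (φ x) b ↔ ∃ y, b = φ y ∧ R x y) {x y : α} :
    ReflTransGen R' (φ x) (φ y) ↔ ReflTransGen R x y := by
  constructor
  · have key : ∀ b, ReflTransGen R' (φ x) b → ∃ y, b = φ y ∧ ReflTransGen R x y := by
      intro b hb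
      induction hb with
      | refl => exact ⟨x, rfl, .refl⟩
      | tail _ hbc ih =>
        obtain ⟨y, rfl, hy⟩ := ih
        obtain ⟨z, rfl, hz⟩ := (h _ _).1 hbc
        exact ⟨z, rfl, hy.tail hz⟩
    intro hxy
    obtain ⟨z, hz, hxz⟩ := key _ hxy
    rwa [hφ hz]
  · exact fun hxy => hxy.lift φ fun a b hab => (h _ _).2 ⟨b, rfl, hab⟩

/-! ### Terms -/

theorem Srt.int_sub (s : Srt) : Srt.int.Sub s := by cases s <;> simp [Srt.Sub]

theorem Term.substList_eq (θ : Subst) (ts : List Term) :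
    Term.substList θ ts = ts.map (Term.subst θ) := by
  induction ts with
  | nil => rfl
  | cons t ts ih => rw [Term.substList, ih]; rfl

theorem Term.wellSortedList_iff {ts : List Term} {ss : List Srt} :
    Term.WellSortedList ts ss ↔
      List.Forall₂ (fun (t : Term) (s : Srt) => t.WellSorted ∧ t.sort.Sub s) ts ss := by
  induction ts generalizing ss with
  | nil => cases ss <;> simp [Term.WellSortedList]
  | cons t ts ih => cases ss <;> simp [Term.WellSortedList, ih, and_assoc]

mutual
theorem Term.Precomputed.norm_eq : ∀ t : Term, t.Precomputed → t.norm = t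
  | .var _, h => by simp [Term.Precomputed] at h
  | .num _, _ => rfl
  | .arith _ _ _, h => by simp [Term.Precomputed] at h
  | .app f ts, h => by
    rw [Term.Precomputed] at h
    rw [Term.norm, Term.PrecomputedList.norm_eq ts h]
theorem Term.PrecomputedList.norm_eq : ∀ ts : List Term, Term.PrecomputedList ts →
    Term.normList ts = ts
  | [], _ => rfl
  | t :: ts, h => by
    rw [Term.PrecomputedList] at h
    rw [Term.normList, Term.Precomputed.norm_eq t h.1, Term.PrecomputedList.norm_eq ts h.2]
end

mutual
theorem Term.Precomputed.subst_eq (θ : Subst) : ∀ t : Term, t.Precomputed → t.subst θ = t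
  | .var _, h => by simp [Term.Precomputed] at h
  | .num _, _ => rfl
  | .arith _ _ _, h => by simp [Term.Precomputed] at h
  | .app f ts, h => by
    rw [Term.Precomputed] at h
    rw [Term.subst, Term.PrecomputedList.subst_eq θ ts h]
theorem Term.PrecomputedList.subst_eq (θ : Subst) : ∀ ts : List Term, Term.PrecomputedList ts →
    Term.substList θ ts = ts
  | [], _ => rfl
  | t :: ts, h => by
    rw [Term.PrecomputedList] at h
    rw [Term.substList, Term.Precomputed.subst_eq θ t h.1, Term.PrecomputedList.subst_eq θ ts h.2]
end

theorem Term.norm_sort (t : Term) : t.norm.sort = t.sort := by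
  cases t with
  | arith op a b => rw [Term.norm]; split <;> rfl
  | _ => simp [Term.norm, Term.sort]

mutual
theorem Term.WellSorted.norm : ∀ t : Term, t.WellSorted → t.norm.WellSorted
  | .var _, _ => by simp [Term.norm, Term.WellSorted]
  | .num _, _ => by simp [Term.norm, Term.WellSorted]
  | .arith op a b, h => by
    rw [Term.WellSorted] at h
    have ha := Term.WellSorted.norm a h.1
    have hb := Term.WellSorted.norm b h.2.1
    rw [Term.norm]
    split
    · simp [Term.WellSorted]
    · rw [Term.WellSorted, Term.norm_sort, Term.norm_sort]
      exact ⟨ha, hb, h.2.2⟩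
  | .app f ts, h => by
    rw [Term.WellSorted] at h
    rw [Term.norm, Term.WellSorted]
    exact Term.WellSortedList.norm ts f.args h
theorem Term.WellSortedList.norm : ∀ (ts : List Term) (ss : List Srt), Term.WellSortedList ts ss →
    Term.WellSortedList (Term.normList ts) ss
  | [], [], _ => by simp [Term.normList, Term.WellSortedList]
  | [], _ :: _, h => by simp [Term.WellSortedList] at h
  | _ :: _, [], h => by simp [Term.WellSortedList] at h
  | t :: ts, s :: ss, h => by
    rw [Term.WellSortedList] at h
    rw [Term.normList, Term.WellSortedList, Term.norm_sort]
    exact ⟨Term.WellSorted.norm t h.1, h.2.1, Term.WellSortedList.norm ts ss h.2.2⟩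
end

theorem Term.isVar_syn (t : Term) : t.syn.isVar = true ↔ ∃ v, t = .var v := by
  cases t <;> simp [Term.syn, isVar, tag]

theorem Term.isInt_syn (t : Term) : t.syn.isInt = true ↔ t.sort = .int := by
  cases t with
  | var v => simp [Term.syn, isInt, isVar, tag, arg, args, Term.sort, Srt.syn_injective.eq_iff]
  | num z => simp [Term.syn, isInt, tag, Term.sort]
  | arith op a b => cases op <;> simp [Term.syn, isInt, tag, Term.sort]
  | app f ts => simp [Term.syn, isInt, isVar, tag, arg, args, Term.sort, Srt.syn_injective.eq_iff]

/-! ### Substitutions -/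

open Classical in
/-- A partial assignment of terms to variables extends to a substitution. -/
theorem exists_subst (R : Var → Term → Prop)
    (hR : ∀ v t, R v t → t.WellSorted ∧ t.sort.Sub v.sort) :
    ∃ θ : Subst, ∀ v, ((∃ t, R v t) → R v (θ.map v)) ∧ ((¬∃ t, R v t) → θ.map v = .num 0) := by
  have key : ∀ v, ∃ t : Term, (t.WellSorted ∧ t.sort.Sub v.sort) ∧ ((∃ t, R v t) → R v t) ∧
      ((¬∃ t, R v t) → t = .num 0) := by
    intro v
    by_cases h : ∃ t, R v t
    · obtain ⟨t, ht⟩ := h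
      exact ⟨t, hR v t ht, fun _ => ht, fun h => absurd ⟨t, ht⟩ h⟩
    -- A numeral fits variables of both sorts. That the default is the same for all variables
    -- matters for unification.
    · exact ⟨.num 0, ⟨by simp [Term.WellSorted], Srt.int_sub _⟩, fun h' => absurd h' h,
        fun _ => rfl⟩
  choose f hf hf' using key
  exact ⟨⟨f, fun v => (hf v).1, fun v => (hf v).2⟩, hf'⟩

theorem SimpleTuple.ground {u : List Term} (h : SimpleTuple u) {t : Term} (ht : t ∈ u)
    (hv : ¬t.syn.isVar = true) : t.WellSorted ∧ t.Precomputed :=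
  (h.1 t ht).resolve_left (mt (Term.isVar_syn t).2 hv)

theorem SimpleTuple.eq_of_getElem_eq_var {u : List Term} (h : SimpleTuple u) {i j : ℕ}
    (hi : i < u.length) (hj : j < u.length) {v : Var} (h1 : u[i] = .var v) (h2 : u[j] = .var v) :
    i = j := by
  have hp := List.pairwise_iff_getElem.1 h.2
  rcases lt_trichotomy i j with hij | hij | hij
  · exact absurd h2 (hp i j hi hj hij v h1)
  · exact hij
  · exact absurd h1 (hp j i hj hi hij v h2)

theorem SimpleTuple.map_norm {u : List Term} (h : SimpleTuple u) : u.map Term.norm = u := by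
  conv_rhs => rw [← List.map_id u]
  refine List.map_congr_left fun t ht => ?_
  rcases h.1 t ht with ⟨v, rfl⟩ | ⟨_, h⟩
  · rfl
  · exact h.norm_eq t

theorem matchTerm_iff {u t : Term} : matchTerm u.syn t.syn = true ↔
    (∀ v, u = .var v → t.sort.Sub v.sort) ∧ (¬u.syn.isVar = true → u = t) := by
  by_cases hu : u.syn.isVar = true
  · obtain ⟨v, rfl⟩ := (Term.isVar_syn u).1 hu
    have e : (Term.var v).syn.arg 0 = v.sort.syn := rfl
    simp only [matchTerm, hu, cond_true, Bool.or_eq_true, decide_eq_true_eq, e,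
      Srt.syn_injective.eq_iff, Term.isInt_syn, Term.var.injEq, Srt.Sub]
    constructor
    · rintro (h | h)
      · exact ⟨fun w hw => by subst hw; exact .inr h, fun h => absurd trivial h⟩
      · refine ⟨fun w hw => ?_, fun h => absurd trivial h⟩
        rw [h]
        exact Srt.int_sub _
    · rintro ⟨h, -⟩
      rcases h v rfl with h | h
      · cases hs : v.sort
        · exact .inr (h.trans hs)
        · exact .inl rfl
      · exact .inl h
  · have : ∀ v, u ≠ .var v := fun v hv => hu ((Term.isVar_syn u).2 ⟨v, hv⟩)
    simp only [matchTerm, hu, decide_eq_true_eq, cond_false]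
    constructor
    · exact fun h => ⟨fun v hv => absurd hv (this v), fun _ => Term.syn_injective _ _ h⟩
    · exact fun h => congrArg _ (h.2 (by simp))

/-- A substitution fixes precomputed terms and respects sorts, so the tests are necessary.
Conversely, the pairs of a variable and the term at its position define a substitution, because the
variables are distinct. -/
theorem matchTuple_iff {us ts : List Term} (hu : SimpleTuple us) (hl : us.length = ts.length)
    (ht : ∀ t ∈ ts, t.WellSorted) :
    matchTuple (us.map Term.syn) (ts.map Term.syn) = true ↔
      ∃ θ : Subst, ts = Term.substList θ us := by
  have e : matchTuple (us.map Term.syn) (ts.map Term.syn) = true ↔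
      ∀ x ∈ us.zip ts, matchTerm x.1.syn x.2.syn = true := by
    rw [matchTuple, List.zip_map, List.all_map, List.all_eq_true]
    rfl
  rw [e]
  simp only [Term.substList_eq]
  constructor
  · intro h
    obtain ⟨θ, hθ⟩ := exists_subst (fun v t => (Term.var v, t) ∈ us.zip ts) fun v t hv =>
      ⟨ht _ (List.of_mem_zip hv).2, (matchTerm_iff.1 (h _ hv)).1 v rfl⟩
    refine ⟨θ, List.ext_getElem (by simp [hl]) fun i h1 h2 => ?_⟩
    have hi : i < us.length := by omega
    have hz : (us[i], ts[i]) ∈ us.zip ts := by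
      rw [List.mem_iff_getElem]
      exact ⟨i, by simp; omega, by simp⟩
    rw [List.getElem_map]
    by_cases hv : us[i].syn.isVar = true
    · obtain ⟨v, hv⟩ := (Term.isVar_syn _).1 hv
      rw [hv] at hz
      have := (hθ v).1 ⟨_, hz⟩
      obtain ⟨j, hj, hjv⟩ := List.mem_iff_getElem.1 this
      simp only [List.getElem_zip, Prod.mk.injEq] at hjv
      simp only [List.length_zip] at hj
      -- The value of `v` was taken from some position at which `v` stands; there is only one.
      obtain rfl := hu.eq_of_getElem_eq_var hi (by omega) hv hjv.1
      rw [hv, Term.subst]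
      exact hjv.2
    · rw [((hu.ground (List.getElem_mem hi) hv).2).subst_eq θ]
      exact ((matchTerm_iff.1 (h _ hz)).2 hv).symm
  · rintro ⟨θ, rfl⟩ ⟨a, b⟩ hx
    obtain ⟨i, hi, hx⟩ := List.mem_iff_getElem.1 hx
    simp only [List.getElem_zip, List.getElem_map, Prod.mk.injEq] at hx
    simp only [List.length_zip] at hi
    obtain ⟨rfl, rfl⟩ := hx
    refine matchTerm_iff.2 ⟨fun v hv => ?_, fun hv => ?_⟩
    · have := θ.sort_sub v
      dsimp only at hv ⊢
      rwa [hv, Term.subst]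
    · exact (((hu.ground (List.getElem_mem _) hv).2).subst_eq θ _).symm

/-! ### Matching -/

/-- The representation of a predicate symbol. -/
def PredSym.key (p : PredSym) : Syn × Syn := (.int p.idx, sortsSyn p.args)

theorem PredSym.key_injective : Injective PredSym.key := by
  rintro ⟨i, a⟩ ⟨j, b⟩ h
  simp only [PredSym.key, Prod.mk.injEq, Syn.int.injEq, Nat.cast_inj,
    sortsSyn_injective.eq_iff] at h
  rw [h.1, h.2]

theorem Atom.key_syn (A : Atom) : A.syn.key = A.pred.key := rfl

theorem Atom.tuple_syn (A : Atom) : A.syn.tuple = (A.args.map Term.norm).map Term.syn := by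
  rw [List.map_map]
  rfl

/-- Well-sortedness of the atom makes its arguments as many as the entries of the tuple, so that
zipping loses nothing, and survives evaluation, so that the entries are admissible values of a
substitution. -/
theorem matchAtom_iff {κ : Intensionality} (hκ : κ.Simple) {A : Atom} (hA : A.WellSorted) :
    matchAtom (List.map Atom.syn κ) A.syn = true ↔ Matches κ A.pred A.args := by
  have hA' := Term.wellSortedList_iff.1 (Term.WellSortedList.norm _ _ hA)
  have hlen := hA'.length_eq
  have hws : ∀ t ∈ Term.normList A.args, t.WellSorted := fun t ht => by
    obtain ⟨i, hi, rfl⟩ := List.mem_iff_getElem.1 ht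
    exact (hA'.get hi (by omega)).1
  simp only [matchAtom, List.any_map, List.any_eq_true, comp_apply, Bool.and_eq_true,
    decide_eq_true_eq, Atom.key_syn, PredSym.key_injective.eq_iff, Atom.tuple_syn, Matches,
    Intensionality.tuples, Set.mem_ofPred_eq]
  constructor
  · rintro ⟨⟨p, u⟩, hB, hp, h⟩
    dsimp only at hp h
    subst hp
    obtain ⟨h1, h2⟩ := hκ _ u hB
    rw [h2.map_norm, ← Term.normList_eq, matchTuple_iff h2 (by omega) hws] at h
    exact ⟨u, hB, h⟩
  · rintro ⟨u, hB, h⟩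
    obtain ⟨h1, h2⟩ := hκ _ u hB
    refine ⟨⟨A.pred, u⟩, hB, rfl, ?_⟩
    dsimp only
    rw [h2.map_norm, ← Term.normList_eq, matchTuple_iff h2 (by omega) hws]
    exact h

/-! ### Unification -/

/-- If the test succeeds, each component of the graph contains at most one precomputed term: map its
variables to that term, or to 0 if there is none. Conversely, a unifier gives the two ends of an
edge the same value, hence all of a component, and it fixes precomputed terms and respects sorts. -/
theorem unifyTuple_iff {us ws : List Term} (hu : SimpleTuple us) (hw : SimpleTuple ws)
    (hl : us.length = ws.length) :
    unifyTuple (us.map Term.syn) (ws.map Term.syn) = true ↔ Unify us ws := by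
  set G : Term → Term → Prop := fun x y => (x, y) ∈ us.zip ws ++ ws.zip us with hG
  have hr : ∀ g x : Term, reach ((us.map Term.syn).zip (ws.map Term.syn) ++
      (ws.map Term.syn).zip (us.map Term.syn)) g.syn x.syn = true ↔ ReflTransGen G g x := by
    intro g x
    rw [reach_iff, ← reflTransGen_map_iff (R := G) (φ := Term.syn)
      (fun a b h => Term.syn_injective a b h)]
    intro a b
    rw [List.zip_map, List.zip_map, ← List.map_append, List.mem_map]
    constructor
    · rintro ⟨⟨c, d⟩, hcd, h⟩
      simp only [Prod.map_apply, Prod.mk.injEq] at h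
      obtain rfl := Term.syn_injective _ _ h.1
      exact ⟨d, h.2.symm, hcd⟩
    · rintro ⟨y, rfl, h⟩
      exact ⟨(a, y), h, rfl⟩
  have hsymm : ∀ x y, G x y → G y x := by
    have : ∀ {l l' : List Term} {x y : Term}, (x, y) ∈ l.zip l' → (y, x) ∈ l'.zip l := by
      intro l l' x y h
      rw [← List.zip_swap]
      exact List.mem_map.2 ⟨_, h, rfl⟩
    intro x y h
    rcases List.mem_append.1 h with h | h
    · exact List.mem_append.2 (.inr (this h))
    · exact List.mem_append.2 (.inl (this h))
  have hsymm' : ∀ {x y}, ReflTransGen G x y → ReflTransGen G y x := fun h =>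
    ReflTransGen.mono (fun a b hab => hsymm _ _ hab) _ _ (reflTransGen_swap.1 h)
  have hgr : ∀ t ∈ us ++ ws, ¬t.syn.isVar = true → t.WellSorted ∧ t.Precomputed := fun t ht hv =>
    (List.mem_append.1 ht).elim (fun h => hu.ground h hv) fun h => hw.ground h hv
  have e : unifyTuple (us.map Term.syn) (ws.map Term.syn) = true ↔
      ∀ g ∈ us ++ ws, ¬g.syn.isVar = true → ∀ x ∈ us ++ ws, ReflTransGen G g x →
        (∀ v, x = .var v → g.sort.Sub v.sort) ∧ (¬x.syn.isVar = true → x = g) := by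
    rw [unifyTuple, Bool.not_eq_true', ← List.map_append, List.any_eq_false]
    simp only [List.forall_mem_map, List.any_eq_true, not_exists, not_and, Bool.and_eq_true, hr,
      Bool.not_eq_true', Bool.not_eq_false, matchTerm_iff]
    exact forall₂_congr fun g _ => ⟨fun h hv x hx hgx => h x hx ⟨by simpa using hv, hgx⟩,
      fun h x hx hv => h (by simpa using hv.1) x hx hv.2⟩
  rw [e]
  constructor
  · intro h
    obtain ⟨θ, hθ⟩ := exists_subst
      (fun v t => Term.var v ∈ us ++ ws ∧ t ∈ us ++ ws ∧ ¬t.syn.isVar = true ∧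
        ReflTransGen G t (.var v))
      fun v t ⟨h1, h2, h3, h4⟩ => ⟨(hgr t h2 h3).1, (h t h2 h3 _ h1 h4).1 v rfl⟩
    have key1 : ∀ x ∈ us ++ ws, ∀ g ∈ us ++ ws, ¬g.syn.isVar = true → ReflTransGen G g x →
        x.subst θ = g := by
      intro x hx g hg hgv hgx
      by_cases hxv : x.syn.isVar = true
      · obtain ⟨v, rfl⟩ := (Term.isVar_syn x).1 hxv
        obtain ⟨-, h2, h3, h4⟩ := (hθ v).1 ⟨g, hx, hg, hgv, hgx⟩
        -- The term chosen for `v` and the given `g` are connected through `v`, so the test makes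
        -- them equal.
        exact ((h _ h2 h3 g hg (h4.trans (hsymm' hgx))).2 hgv).symm
      · obtain rfl := (h g hg hgv x hx hgx).2 hxv
        exact (hgr x hx hxv).2.subst_eq θ
    have key2 : ∀ x ∈ us ++ ws, (¬∃ g ∈ us ++ ws, ¬g.syn.isVar = true ∧ ReflTransGen G g x) →
        x.subst θ = .num 0 := by
      intro x hx hn
      by_cases hxv : x.syn.isVar = true
      · obtain ⟨v, rfl⟩ := (Term.isVar_syn x).1 hxv
        refine (hθ v).2 ?_
        rintro ⟨t, -, h2, h3, h4⟩
        exact hn ⟨t, h2, h3, h4⟩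
      · exact absurd ⟨x, hx, hxv, .refl⟩ hn
    refine ⟨θ, ?_⟩
    rw [Term.substList_eq, Term.substList_eq]
    refine List.ext_getElem (by simpa using hl) fun i h1 h2 => ?_
    simp only [List.length_map] at h1 h2
    rw [List.getElem_map, List.getElem_map]
    have hz : G us[i] ws[i] := List.mem_append.2 (.inl (List.mem_iff_getElem.2
      ⟨i, by simp; omega, by simp⟩))
    have hm1 : us[i] ∈ us ++ ws := List.mem_append.2 (.inl (List.getElem_mem _))
    have hm2 : ws[i] ∈ us ++ ws := List.mem_append.2 (.inr (List.getElem_mem _))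
    -- Both ends of the edge lie in one component, so either both take the value of its precomputed
    -- term or both become 0.
    by_cases hc : ∃ g ∈ us ++ ws, ¬g.syn.isVar = true ∧ ReflTransGen G g us[i]
    · obtain ⟨g, hg, hgv, hgx⟩ := hc
      rw [key1 _ hm1 g hg hgv hgx, key1 _ hm2 g hg hgv (hgx.tail hz)]
    · rw [key2 _ hm1 hc, key2 _ hm2]
      rintro ⟨g, hg, hgv, hgx⟩
      exact hc ⟨g, hg, hgv, hgx.tail (hsymm _ _ hz)⟩
  · rintro ⟨θ, hθ⟩ g hg hgv x hx hgx
    rw [Term.substList_eq, Term.substList_eq] at hθ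
    have h1 : ∀ a b, (a, b) ∈ us.zip ws → a.subst θ = b.subst θ := by
      intro a b hab
      obtain ⟨i, hi, hab⟩ := List.mem_iff_getElem.1 hab
      simp only [List.getElem_zip, Prod.mk.injEq] at hab
      simp only [List.length_zip] at hi
      have := List.getElem_of_eq hθ (i := i) (by simp; omega)
      simpa [hab.1, hab.2] using this
    have h2 : ∀ a b, G a b → a.subst θ = b.subst θ := by
      intro a b hab
      rcases List.mem_append.1 hab with h | h
      · exact h1 a b h
      · refine (h1 b a ?_).symm
        rw [← List.zip_swap]
        exact List.mem_map.2 ⟨_, h, rfl⟩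
    have h3 : g.subst θ = x.subst θ := by
      clear hx
      induction hgx with
      | refl => rfl
      | tail _ hbc ih => exact ih.trans (h2 _ _ hbc)
    rw [(hgr g hg hgv).2.subst_eq θ] at h3
    refine ⟨fun v hv => ?_, fun hv => ?_⟩
    · rw [h3, hv]
      exact θ.sort_sub v
    · exact (h3.trans ((hgr x hx hv).2.subst_eq θ _)).symm

end

section

open Turing Function Relation

open Syn

/-! ### Correctness of the decision procedure -/

/-- The modules of a program, as they result from parsing. -/
def LPModule.synModule (Δ : LPModule) : SynModule :=
  (Δ.int.map Atom.syn, Δ.rules.map Rule.synPair)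

theorem isAtom_headSyn {r : Rule} : r.synPair.1.isAtom = true ↔ ∃ A, r.head = some (.atom A) := by
  unfold Rule.synPair
  rcases r.head with _ | (A | ⟨a, b⟩ | ⟨c, a, b⟩) <;>
    simp [headSyn, isAtom, tag, AtomicFormula.syn, Atom.syn]

theorem headSyn_atom {r : Rule} {A : Atom} (h : r.head = some (.atom A)) :
    r.synPair.1 = A.syn := by
  simp [Rule.synPair, h, headSyn, AtomicFormula.syn]

theorem mem_posAtoms {r : Rule} {x : Syn} :
    x ∈ posAtoms r.synPair ↔ ∃ B, Literal.pos (.atom B) ∈ r.body ∧ x = B.syn := by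
  simp only [posAtoms, Rule.synPair, Syn.args, List.mem_map, List.mem_filter]
  constructor
  · rintro ⟨_, ⟨⟨L, hL, rfl⟩, h⟩, rfl⟩
    rcases L with (A | ⟨a, b⟩ | ⟨c, a, b⟩) | F | F
    · exact ⟨A, hL, rfl⟩
    all_goals simp [Literal.syn, AtomicFormula.syn, tag, isAtom, arg, Syn.args] at h
  · rintro ⟨B, hB, rfl⟩
    refine ⟨_, ⟨⟨_, hB, rfl⟩, ?_⟩, rfl⟩
    simp [Literal.syn, AtomicFormula.syn, tag, isAtom, arg, Syn.args, Atom.syn]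

namespace ModularProgram

variable (P : ModularProgram)

/-- The modules of the program, as they result from parsing. -/
def synModules : List SynModule := P.modules.map LPModule.synModule

variable {P}

theorem wellSorted_head {Δ : LPModule} (hΔ : Δ ∈ P.modules) {r : Rule} (hr : r ∈ Δ.rules)
    {A : Atom} (hA : r.head = some (.atom A)) : A.WellSorted :=
  ((P.wellFormed Δ hΔ).2 r hr).1 _ hA

theorem wellSorted_body {Δ : LPModule} (hΔ : Δ ∈ P.modules) {r : Rule} (hr : r ∈ Δ.rules)
    {A : Atom} (hA : Literal.pos (.atom A) ∈ r.body) : A.WellSorted :=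
  ((P.wellFormed Δ hΔ).2 r hr).2 _ hA

theorem simpleTest_iff : simpleTest P.synModules = true ↔ P.Simple := by
  simp only [simpleTest, synModules, List.all_map, List.all_eq_true, comp_apply,
    LPModule.synModule, Bool.or_eq_true, Bool.not_eq_true', Simple, LPModule.Simple]
  refine forall₂_congr fun Δ hΔ => forall₂_congr fun r hr => ?_
  constructor
  · intro h p t hh
    have h1 := isAtom_headSyn.2 ⟨_, hh⟩
    rw [headSyn_atom hh] at h h1
    exact (matchAtom_iff (P.wellFormed Δ hΔ).1 (wellSorted_head hΔ hr hh)).1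
      (h.resolve_left (by simp [h1]))
  · intro h
    cases hi : r.synPair.1.isAtom
    · exact .inl rfl
    · obtain ⟨A, hA⟩ := isAtom_headSyn.1 hi
      rw [headSyn_atom hA]
      exact .inr ((matchAtom_iff (P.wellFormed Δ hΔ).1 (wellSorted_head hΔ hr hA)).2 (h _ _ hA))

theorem mem_zipIdx {x : SynModule × ℕ} : x ∈ P.synModules.zipIdx ↔
    ∃ i : Fin P.modules.length, x = ((P.modules.get i).synModule, (i : ℕ)) := by
  rw [List.mem_iff_getElem]
  constructor
  · rintro ⟨i, hi, rfl⟩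
    simp only [List.length_zipIdx, synModules, List.length_map] at hi
    exact ⟨⟨i, hi⟩, by simp [synModules]⟩
  · rintro ⟨i, rfl⟩
    exact ⟨i, by simp [synModules], by simp [synModules]⟩

/-- The representation of a vertex of the dependency graph. -/
def vertexKey (v : P.Vertex) : (Syn × Syn) × ℕ := (v.1.key, v.2)

theorem vertexKey_injective : Injective (vertexKey (P := P)) := by
  rintro ⟨p, i⟩ ⟨q, j⟩ h
  simp only [vertexKey, Prod.mk.injEq, PredSym.key_injective.eq_iff] at h
  rw [h.1, Fin.ext h.2]

theorem mem_edgeList {e : ((Syn × Syn) × ℕ) × ((Syn × Syn) × ℕ)} :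
    e ∈ edgeList P.synModules ↔ ∃ v w, P.Edge v w ∧ e = (vertexKey v, vertexKey w) := by
  simp only [edgeList, List.mem_flatMap, mem_zipIdx]
  constructor
  · rintro ⟨_, hm, _, hm', x, hx, _, ⟨i, rfl⟩, _, ⟨j, rfl⟩, h⟩
    obtain ⟨Δ, hΔ, rfl⟩ := List.mem_map.1 hm
    obtain ⟨r, hr, rfl⟩ := List.mem_map.1 hm'
    obtain ⟨B, hB, rfl⟩ := mem_posAtoms.1 hx
    cases hc : isAtom r.synPair.1 && matchAtom (P.modules.get i).synModule.1 r.synPair.1 &&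
      matchAtom (P.modules.get j).synModule.1 B.syn
    · rw [hc] at h
      simp at h
    · simp only [hc, cond_true, List.mem_singleton] at h
      simp only [Bool.and_eq_true] at hc
      obtain ⟨⟨h1, h2⟩, h3⟩ := hc
      obtain ⟨A, hA⟩ := isAtom_headSyn.1 h1
      rw [headSyn_atom hA] at h h2
      exact ⟨(A.pred, i), (B.pred, j), ⟨Δ, hΔ, r, hr, A.args, B.args, hA, hB,
        (matchAtom_iff (P.wellFormed _ (List.get_mem _ _)).1 (wellSorted_head hΔ hr hA)).1 h2,
        (matchAtom_iff (P.wellFormed _ (List.get_mem _ _)).1 (wellSorted_body hΔ hr hB)).1 h3⟩, h⟩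
  · rintro ⟨⟨p, i⟩, ⟨q, j⟩, ⟨Δ, hΔ, r, hr, t, t', hA, hB, h2, h3⟩, rfl⟩
    refine ⟨_, List.mem_map.2 ⟨Δ, hΔ, rfl⟩, _, List.mem_map.2 ⟨r, hr, rfl⟩, _,
      mem_posAtoms.2 ⟨_, hB, rfl⟩, _, ⟨i, rfl⟩, _, ⟨j, rfl⟩, ?_⟩
    have k1 := isAtom_headSyn.2 ⟨_, hA⟩
    have k2 := (matchAtom_iff (P.wellFormed _ (List.get_mem _ i)).1
      (wellSorted_head hΔ hr hA)).2 h2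
    have k3 := (matchAtom_iff (P.wellFormed _ (List.get_mem _ j)).1
      (wellSorted_body hΔ hr hB)).2 h3
    rw [headSyn_atom hA] at k1 ⊢
    simp only [LPModule.synModule, k1, k2, k3, Bool.and_self, cond_true, List.mem_singleton]
    rfl

/-- On a walk inside a component every edge lies on a closed walk. If no such edge changes the
module, then the module is constant along the walk, hence on the component. -/
theorem component_iff : (∀ v : P.Vertex, ∃ i, ∀ w ∈ P.component v, w.2 = i) ↔
    ∀ v w, P.Edge v w → ReflTransGen P.Edge w v → v.2 = w.2 := by
  constructor
  · intro h v w hvw hwv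
    obtain ⟨i, hi⟩ := h v
    rw [hi v ⟨.refl, .refl⟩, hi w ⟨.single hvw, hwv⟩]
  · intro h v
    refine ⟨v.2, ?_⟩
    rintro w ⟨hvw, hwv⟩
    induction hvw with
    | refl => rfl
    -- The last edge `hxw` closes up through the way back from its target to `v` and the walk from
    -- `v` to its source.
    | tail hvx hxw ih => rw [← ih (.head hxw hwv), h _ _ hxw (hwv.trans hvx)]

theorem componentTest_iff : componentTest P.synModules = true ↔
    ∀ v : P.Vertex, ∃ i, ∀ w ∈ P.component v, w.2 = i := by
  rw [component_iff]
  have hr : ∀ v w : P.Vertex, reach (edgeList P.synModules) (vertexKey v) (vertexKey w) = true ↔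
      ReflTransGen P.Edge v w := by
    intro v w
    rw [reach_iff, ← reflTransGen_map_iff (R := P.Edge) vertexKey_injective]
    intro v b
    rw [mem_edgeList]
    constructor
    · rintro ⟨v', w, hvw, h⟩
      simp only [Prod.mk.injEq] at h
      obtain rfl := vertexKey_injective h.1
      exact ⟨w, h.2, hvw⟩
    · rintro ⟨w, rfl, h⟩
      exact ⟨v, w, h, rfl⟩
  simp only [componentTest, List.all_eq_true, Bool.or_eq_true, decide_eq_true_eq,
    Bool.not_eq_true']
  constructor
  · intro h v w hvw hwv
    rcases h _ (mem_edgeList.2 ⟨v, w, hvw, rfl⟩) with h | h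
    · exact Fin.ext h
    · rw [(hr w v).2 hwv] at h
      simp at h
  · intro h e he
    obtain ⟨v, w, hvw, rfl⟩ := mem_edgeList.1 he
    cases hc : reach (edgeList P.synModules) (vertexKey w) (vertexKey v)
    · exact .inr rfl
    · exact .inl (congrArg Fin.val (h v w hvw ((hr w v).1 hc)))

theorem disjointTest_iff : disjointTest P.synModules = true ↔
    ∀ i j : Fin P.modules.length, i ≠ j → ∀ p,
      ∀ u ∈ (P.modules.get i).int.tuples p, ∀ w ∈ (P.modules.get j).int.tuples p, ¬Unify u w := by
  simp only [disjointTest, List.all_eq_true, mem_zipIdx, forall_exists_index, forall_eq_apply_imp_iff,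
    Bool.or_eq_true, decide_eq_true_eq, LPModule.synModule, List.forall_mem_map, Bool.not_eq_true',
    decide_eq_false_iff_not, Atom.key_syn, PredSym.key_injective.eq_iff, Atom.tuple_syn]
  refine forall₂_congr fun i j => ?_
  rw [← Fin.ext_iff, or_iff_not_imp_left]
  refine forall_congr' fun _ => ?_
  have hi := (P.wellFormed _ (List.get_mem _ i)).1
  have hj := (P.wellFormed _ (List.get_mem _ j)).1
  constructor
  · intro h p u hu w hw
    have h1 := (h _ hu _ hw).resolve_left (fun h => h rfl)
    dsimp only at h1
    obtain ⟨l1, s1⟩ := hi p u hu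
    obtain ⟨l2, s2⟩ := hj p w hw
    rw [s1.map_norm, s2.map_norm] at h1
    rw [← unifyTuple_iff s1 s2 (by omega), h1]
    simp
  · rintro h ⟨p, u⟩ hu ⟨q, w⟩ hw
    by_cases hpq : p = q
    · subst hpq
      right
      dsimp only
      obtain ⟨l1, s1⟩ := hi p u hu
      obtain ⟨l2, s2⟩ := hj p w hw
      have h1 := h p u hu w hw
      rw [s1.map_norm, s2.map_norm]
      rw [← unifyTuple_iff s1 s2 (by omega)] at h1
      simpa using h1
    · exact .inl hpq

theorem coherentTest_iff : coherentTest P.synModules = true ↔ P.Coherent := by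
  simp only [coherentTest, Bool.and_eq_true, simpleTest_iff, componentTest_iff, disjointTest_iff,
    Coherent, and_assoc]

/-- Parsing leaves two items, of which the second lists the modules; undoing the two levels of
pairing recovers them. -/
theorem synModules_foldr (P : ModularProgram) :
    ModASP.synModules (P.enc.foldr parseStep ([], [])) = P.synModules := by
  rw [P.parses [] []]
  simp only [ModASP.synModules, synModules, List.cons_append, List.nil_append, List.tail_cons,
    List.headD_cons, Syn.args, pairUp_unpair, List.map_map]
  refine List.map_congr_left fun Δ _ => ?_
  simp [LPModule.synPair, LPModule.synModule, pairUp_unpair]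

end ModularProgram

/-! ### Reading the input -/

open TreeRep Prog TM2.Stmt

/-- The stacks while the input is read: the rest of the input, and the main stack. -/
def readStk (l : List Tok) (m : List Bool) : Stks
  | none => l
  | some i => stks m [] [] [] (some i)

theorem readStk_nil (m : List Bool) : readStk [] m = stks m [] [] [] := by
  funext k
  cases k <;> rfl

theorem readStk_inputStk (l : List Tok) : readStk l [] = inputStk l := by
  funext k
  rcases k with _ | i
  · rfl
  · fin_cases i <;> rfl

@[simp] theorem readStk_none (l : List Tok) (m : List Bool) : readStk l m none = l := rfl

@[simp] theorem readStk_zero (l : List Tok) (m : List Bool) : readStk l m (some 0) = m := rfl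

@[simp] theorem update_readStk_none (l l' : List Tok) (m : List Bool) :
    update (readStk l m) none l' = readStk l' m := by
  funext k
  cases k <;> rfl

@[simp] theorem update_readStk_zero (l : List Tok) (m m' : List Bool) :
    update (readStk l m) (some 0) m' = readStk l m' := by
  funext k
  rcases k with _ | i
  · rfl
  · fin_cases i <;> rfl

/-- Push a string, the last symbol first. -/
def pushAll : List Bool → Block Bool → Block Bool
  | [], q => q
  | x :: w, q => pushAll w (.push (some 0) (fun _ => x) q)

theorem stepAux_pushAll (w : List Bool) (q : Block Bool) (v : Mem) (l : List Tok) (m : List Bool) :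
    TM2.stepAux (pushAll w q) v (readStk l m) = TM2.stepAux q v (readStk l (w ++ m)) := by
  induction w generalizing q with
  | nil => rfl
  | cons x w ih => rw [pushAll, ih]; simp

/-- Push the representation of the token that is stored in the memory. -/
noncomputable def pushTok : List Tok → Block Bool
  | [] => goto fun _ => false
  | t :: ts => .branch (fun v => decide (v.2.2 = some t))
      (pushAll (true :: (enc t).flat) (goto fun _ => true)) (pushTok ts)

theorem stepAux_pushTok (ts : List Tok) (t : Tok) (ht : t ∈ ts) (v : Mem) (hv : v.2.2 = some t)
    (l : List Tok) (m : List Bool) : TM2.stepAux (pushTok ts) v (readStk l m) =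
      ⟨some true, v, readStk l (true :: (enc t).flat ++ m)⟩ := by
  induction ts with
  | nil => simp at ht
  | cons t' ts ih =>
    rw [pushTok]
    by_cases h : t = t'
    · subst h
      simp [hv, stepAux_pushAll]
    · simp [hv, h, ih ((List.mem_cons.1 ht).resolve_left h)]

theorem stepAux_pushTok_none (ts : List Tok) (v : Mem) (hv : v.2.2 = none) (S : Stks) :
    TM2.stepAux (pushTok ts) v S = ⟨some false, v, S⟩ := by
  induction ts with
  | nil => simp [pushTok]
  | cons t ts ih => simp [pushTok, hv, ih]

/-- Move the input to the main stack, as the tree of the reversed list. -/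
noncomputable def readInput : Prog :=
  .seq (.push false)
    (rep (.pop none (fun v t => (v.1, v.2.1, t)) (pushTok Finset.univ.toList)))

/-- The initial `false` is the empty list, and each token is put in front of the tree built so far,
so the list comes out reversed. This is the order in which the parser needs it. -/
theorem run_readInput (l : List Tok) :
    Run readInput (inputStk l) (stks (enc l.reverse).flat [] [] []) (2 * l.length + 2) := by
  have key : ∀ l l' : List Tok, Run (rep (.pop none (fun v t => (v.1, v.2.1, t))
      (pushTok Finset.univ.toList))) (readStk l (enc l').flat)
      (stks (enc (l.reverse ++ l')).flat [] [] []) (2 * l.length + 1) := by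
    intro l
    induction l with
    | nil =>
      intro l'
      refine .loop_false (.intro fun v => ?_)
      rw [TM2.stepAux, readStk_none, List.head?_nil, List.tail_nil, update_readStk_none,
        stepAux_pushTok_none _ _ rfl, readStk_nil]
      exact ⟨rfl, rfl⟩
    | cons t l ih =>
      intro l'
      have h := ih (t :: l')
      rw [List.reverse_cons, List.append_assoc]
      refine (run_rep_true (.intro (S' := readStk l (enc (t :: l')).flat) fun v => ?_) h).mono
        (by simp; omega)
      rw [TM2.stepAux, readStk_none, List.head?_cons, List.tail_cons, update_readStk_none,
        stepAux_pushTok _ t (by simp) _ rfl]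
      exact ⟨rfl, rfl⟩
  have h := Run.seq (S := inputStk l) (S' := readStk l (enc ([] : List Tok)).flat) (n := 1)
    (p := .push false) ?_ (key l [])
  · rw [List.append_nil] at h
    exact h.mono (by omega)
  · rw [← readStk_inputStk]
    exact .blk (.intro fun v => by simp; rfl)

theorem repSize_reverse_toks : ∃ C, ∀ l : List Tok, repSize l.reverse ≤ C * l.length + 1 := by
  obtain ⟨C, hC⟩ := exists_repSize_le Tok
  refine ⟨C + 1, fun l => ?_⟩
  rw [repSize_reverse]
  induction l with
  | nil => simp
  | cons t l ih =>
    have := hC t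
    simp only [repSize_cons, List.length_cons, mul_add, mul_one]
    omega

/-- A function of strings that is computable in polynomial time is computed by a stack machine. -/
theorem PolyTime.nonempty_tm {α : Type} {e : α → List Tok} {p : α → Bool} {F : List Tok → Bool}
    (hF : PolyTime F) (h : ∀ a, F (e a).reverse = p a) :
    Nonempty (TM2ComputableInPolyTime e Computability.encodeBool p) := by
  obtain ⟨c, q, hc⟩ := hF
  obtain ⟨C, hC⟩ := repSize_reverse_toks
  -- The last statement replaces the five-symbol tree of a truth value by a single symbol, the
  -- output format of the machine.
  refine Prog.computableInPolyTime e p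
    (.seq readInput (.seq c (.ite popBool (.push true) (.push false))))
    (2 * .X + 4 + q.comp (C * .X + 1)) fun a => ?_
  have h1 := run_readInput (e a)
  have h2 := (hc (e a).reverse).2 []
  have h3 : Run (.ite popBool (.push true) (.push false))
      (stks ((enc (F (e a).reverse)).flat ++ []) [] [] []) (mainStk [p a]) 2 := by
    rw [h a, enc_bool, mainStk_eq]
    cases p a
    · exact .ite_false (popBool_exits _ _) (run_push _ _ _ _ _)
    · exact .ite_true (popBool_exits _ _) (run_push _ _ _ _ _)
  rw [List.append_nil] at h2
  refine (h1.seq (h2.seq h3)).mono ?_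
  have h4 := eval_le_eval q (hC (e a))
  simp only [Polynomial.eval_add, Polynomial.eval_mul, Polynomial.eval_X, Polynomial.eval_comp,
    Polynomial.eval_natCast, Polynomial.eval_ofNat, Polynomial.eval_one, Nat.cast_id]
  unfold repSize at h4
  omega

end

end ModASP

theorem theorem2 :
    ModASP.DecidableInPolyTime ModASP.ModularProgram.enc ModASP.ModularProgram.Coherent := by
  open ModASP in
  refine PolyTime.nonempty_tm (F := fun l => coherentTest (synModules
    (l.foldl (fun s t => parseStep t s) ([], [])))) ?_ fun P => ?_
  · have h1 := polyTime_parse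
    have h2 := polyTime_synModules
    have h3 := polyTime_coherentTest
    exact h3.comp (h2.comp h1)
  -- Folding the reversed input from the left is folding the input from the right, the form in which
  -- the parser was verified.
  · rw [List.foldl_reverse, P.synModules_foldr, Bool.eq_iff_iff, P.coherentTest_iff]
    simp
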